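/- **Consistency of the control-variates estimator.** Let $\Theta\subset\mathbb R^q$ be compact and let $\theta_0$ lie in the interior of $\Theta$. Let $(X_j(\theta))_{j\in\mathbb Z}$, $\theta\in\Theta$, be a family of real processes that is (jointly in $\theta$) stationary in $j$. Fix $p\ge 1$, write $\mathbf X_j(\theta)=(X_j(\theta),\dots,X_{j+p-1}(\theta))$ and $\varphi(t,\theta)=\mathbb E\,e^{i\langle t,\mathbf X_1(\theta)\rangle}$, and assume that $\theta_0$ is identified: $\varphi(\cdot,\theta)=\varphi(\cdot,\theta_0)$ for $\theta\in\Theta$ implies $\theta=\theta_0$. The observed series $(X_j)_{j\in\mathbb Z}$ has the law of $(X_j(\theta_0))_{j\in\mathbb Z}$; it is stationary and ergodic, and $\alpha$-mixing with coefficients satisfying $\sum_{j\ge1}\alpha_j^{1/r}<\infty$ for some $r>1$ for which also $\mathbb E|X_1|^{u}<\infty$, $u=2r/(r-1)$. Put $\mathbf X_j=(X_j,\dots,X_{j+p-1})$. The simulated blocks $\tilde{\mathbf X}_j=(\tilde{\mathbf X}_j(\theta))_{\theta\in\Theta}$, $j\in\mathbb N$, are iid copies of $(\mathbf X_1(\theta))_{\theta\in\Theta}$,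 independent of $(X_j)_{j\in\mathbb Z}$, and $\theta\mapsto\tilde{\mathbf X}_j(\theta)$ is continuous on $\Theta$ for every $j$. Assume $\mathbb E\sup_{\theta\in\Theta}|X_1(\theta)|^4<\infty$, and that the control variates are nondegenerate: for $\theta\in\Theta$, $t\neq0$ and $a,b,c\in\mathbb R$, if $a\langle t,\mathbf X_1(\theta)\rangle+b\langle t,\mathbf X_1(\theta)\rangle^2+c=0$ a.s., then $a=b=c=0$. Let the weight $w:\mathbb R^p\to\mathbb R$ be positive almost everywhere with $\int w(t)\,dt<\infty$ and $\int w(t)|t|^{-2}\,dt<\infty$. Define $\varphi_n(t)=\frac1n\sum_{j=1}^n e^{i\langle t,\mathbf X_j\rangle}$ and, for a function $f$ on $\mathbb R^p$, $P_{H,\theta}(f)=\frac1H\sum_{j=1}^H f(\tilde{\mathbf X}_j(\theta))$. Let $f_t(x)=e^{i\langle t,x\rangle}$, $h_{\nu,t,\theta}(x)=\langle t,x\rangle^\nu-\mathbb E\langle t,\mathbf X_1(\theta)\rangle^\nu$ for $\nu=1,2$, $h=(h_{1,t,\theta},h_{2,t,\theta})^T$, and $$\varphi_H(t,\theta)=P_{H,\theta}(f_t),\qquad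 \hat\beta=\{P_{H,\theta}(hh^T)-P_{H,\theta}(h)P_{H,\theta}(h^T)\}^{-1}\{P_{H,\theta}(hf_t)-P_{H,\theta}(h)P_{H,\theta}(f_t)\},$$ $$\varphi_H^{(cv)}(t,\theta)=\varphi_H(t,\theta)-\hat\beta^TP_{H,\theta}(h).$$ Let $\hat\mu_n=\frac1n\sum_{j=1}^nX_j$, $\hat\gamma_p(h)=\frac1{n-h}\sum_{j=1}^{n-h}(X_j-\hat\mu_n)(X_{j+h}-\hat\mu_n)$ for $0\le h<p$, $\hat\Gamma_p=(\hat\gamma_p(|i-j|))_{i,j=1}^p$. For a fixed $k>0$ put $$Q^{(cv)}_{n,H,k}(\theta)=\int_{\mathbb R^p}\Big|\varphi_n(t)-\Big(\varphi_H^{(cv)}(t,\theta)1_{\{t^T\hat\Gamma_pt<k\}}+\varphi_H(t,\theta)1_{\{t^T\hat\Gamma_pt\ge k\}}\Big)\Big|^2\frac{w(t)}{t^T\hat\Gamma_pt}\,dt .$$ Let $H=H(n)\to\infty$ as $n\to\infty$, and let $\hat\theta^{(cv)}_{n,H,k}\in\Theta$ be a minimizer of $Q^{(cv)}_{n,H,k}$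 over $\Theta$ whenever one exists (any one, if there are several; arbitrary in $\Theta$ if there is none). Then $\hat\theta^{(cv)}_{n,H,k}\to\theta_0$ almost surely as $n\to\infty$. -/

import Mathlib

open MeasureTheory ProbabilityTheory Filter Topology

namespace CFEst

/-- The block `(x_j, …, x_{j+p-1})` of a real sequence, as a vector of Euclidean `p`-space. -/
noncomputable def block (p : ℕ) (x : ℤ → ℝ) (j : ℤ) : EuclideanSpace ℝ (Fin p) :=
  WithLp.toLp 2 (fun i : Fin p => x (j + (i : ℤ)))

/-- Shift of a two-sided sequence. -/
def shift (x : ℤ → ℝ) : ℤ → ℝ := fun i => x (i + 1)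

/-- `X` is a stationary and ergodic sequence: the shift preserves its law on sequence space and
is ergodic for it (Mathlib's `Ergodic` includes measure preservation, which is stationarity). -/
def IsStationaryErgodic {Ω : Type*} [MeasurableSpace Ω] (P : Measure Ω) (X : ℤ → Ω → ℝ) : Prop :=
  Ergodic shift (P.map (fun ω (i : ℤ) => X i ω))

/-- The strong mixing coefficient `α_m` of a stationary sequence: the supremum of
`|P(A ∩ B) - P(A) P(B)|` over `A ∈ σ(X_i, i ≤ 0)` and `B ∈ σ(X_i, i ≥ m)`. -/
noncomputable def alphaCoeff {Ω : Type*} [MeasurableSpace Ω] (P : Measure Ω) (X : ℤ → Ω → ℝ)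
    (m : ℕ) : ℝ :=
  sSup {a : ℝ | ∃ A B : Set Ω,
    MeasurableSet[⨆ i : {i : ℤ // i ≤ 0}, MeasurableSpace.comap (X i) inferInstance] A ∧
    MeasurableSet[⨆ i : {i : ℤ // (m : ℤ) ≤ i}, MeasurableSpace.comap (X i) inferInstance] B ∧
    a = |P.real (A ∩ B) - P.real A * P.real B|}

/-- `f_t(x) = exp(i⟨t, x⟩)`. -/
noncomputable def expChar {p : ℕ} (t x : EuclideanSpace ℝ (Fin p)) : ℂ :=
  Complex.exp (Complex.I * ((inner ℝ t x : ℝ) : ℂ))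

/-- The empirical characteristic function of the blocks `𝐗_1, …, 𝐗_n` of an observed path `x`. -/
noncomputable def ecf (p n : ℕ) (x : ℤ → ℝ) (t : EuclideanSpace ℝ (Fin p)) : ℂ :=
  (1 / (n : ℂ)) * ∑ j ∈ Finset.range n, expChar t (block p x ((j : ℤ) + 1))

/-- The sample mean of `x_1, …, x_n`. -/
noncomputable def sampleMean (n : ℕ) (x : ℤ → ℝ) : ℝ :=
  (1 / (n : ℝ)) * ∑ j ∈ Finset.range n, x ((j : ℤ) + 1)

/-- The sample autocovariance
`(n-h)⁻¹ ∑_{j=1}^{n-h} (x_j - mean) (x_{j+h} - mean)`, used for `n > h`. -/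
noncomputable def sampleAutocov (n : ℕ) (x : ℤ → ℝ) (h : ℕ) : ℝ :=
  (1 / ((n : ℝ) - (h : ℝ))) * ∑ j ∈ Finset.range (n - h),
    (x ((j : ℤ) + 1) - sampleMean n x) * (x ((j : ℤ) + 1 + (h : ℤ)) - sampleMean n x)

/-- The empirical `p × p` covariance matrix with entries the sample autocovariance
at lag `|i - j|`. -/
noncomputable def sampleCovMatrix (p n : ℕ) (x : ℤ → ℝ) : Matrix (Fin p) (Fin p) ℝ :=
  Matrix.of fun i j => sampleAutocov n x ((i : ℤ) - (j : ℤ)).natAbs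

/-- The estimated variance of `⟨t, 𝐗_1⟩`: the quadratic form of the empirical covariance matrix. -/
noncomputable def estVar (p n : ℕ) (x : ℤ → ℝ) (t : EuclideanSpace ℝ (Fin p)) : ℝ :=
  t.ofLp ⬝ᵥ (sampleCovMatrix p n x).mulVec t.ofLp

section Simulated

variable {p : ℕ}

/-- The empirical distribution of the `H` simulated blocks `y 0, …, y (H-1)`,
applied to a function `f`. -/
noncomputable def empMean (H : ℕ) (y : ℕ → EuclideanSpace ℝ (Fin p))
    (f : EuclideanSpace ℝ (Fin p) → ℂ) : ℂ :=
  (1 / (H : ℂ)) * ∑ j ∈ Finset.range H, f (y j)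

/-- The control functions `h_ν(x) = ⟨t, x⟩^ν - m_ν`, `ν = 1, 2` (here `ν = ν' + 1` for
`ν' : Fin 2`), where `m_ν` is the exact moment `E ⟨t, 𝐗_1(θ)⟩^ν`. -/
noncomputable def ctrl (t : EuclideanSpace ℝ (Fin p)) (m : ℕ → ℝ) (ν : Fin 2)
    (x : EuclideanSpace ℝ (Fin p)) : ℂ :=
  (((inner ℝ t x : ℝ) ^ ((ν : ℕ) + 1) - m ((ν : ℕ) + 1) : ℝ) : ℂ)

/-- The matrix `P_H(h hᵀ) - P_H(h) P_H(hᵀ)`. -/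
noncomputable def ctrlCov (H : ℕ) (y : ℕ → EuclideanSpace ℝ (Fin p))
    (t : EuclideanSpace ℝ (Fin p)) (m : ℕ → ℝ) : Matrix (Fin 2) (Fin 2) ℂ :=
  Matrix.of fun ν κ => empMean H y (fun x => ctrl t m ν x * ctrl t m κ x)
    - empMean H y (ctrl t m ν) * empMean H y (ctrl t m κ)

/-- The estimated optimal coefficient
`{P_H(h hᵀ) - P_H(h) P_H(hᵀ)}⁻¹ {P_H(h f_t) - P_H(h) P_H(f_t)}`. -/
noncomputable def betaHat (H : ℕ) (y : ℕ → EuclideanSpace ℝ (Fin p))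
    (t : EuclideanSpace ℝ (Fin p)) (m : ℕ → ℝ) : Fin 2 → ℂ :=
  (ctrlCov H y t m)⁻¹.mulVec fun ν =>
    empMean H y (fun x => ctrl t m ν x * expChar t x)
      - empMean H y (ctrl t m ν) * empMean H y (expChar t)

/-- The control variates correction `β̂ᵀ P_H(h)`. -/
noncomputable def kappa (H : ℕ) (y : ℕ → EuclideanSpace ℝ (Fin p))
    (t : EuclideanSpace ℝ (Fin p)) (m : ℕ → ℝ) : ℂ :=
  betaHat H y t m ⬝ᵥ fun ν => empMean H y (ctrl t m ν)

/-- The Monte Carlo approximation of the characteristic function. -/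
noncomputable def mcChf (H : ℕ) (y : ℕ → EuclideanSpace ℝ (Fin p))
    (t : EuclideanSpace ℝ (Fin p)) : ℂ :=
  empMean H y (expChar t)

/-- The control variates approximation of the characteristic function. -/
noncomputable def cvChf (H : ℕ) (y : ℕ → EuclideanSpace ℝ (Fin p))
    (t : EuclideanSpace ℝ (Fin p)) (m : ℕ → ℝ) : ℂ :=
  mcChf H y t - kappa H y t m

/-- The integrated weighted squared error of the control variates method, as a function of the
observed path `x`, the simulated blocks `y` and the exact moments `m t ν`, all at one parameter. -/
noncomputable def Qcv (n H : ℕ) (k : ℝ) (w : EuclideanSpace ℝ (Fin p) → ℝ) (x : ℤ → ℝ)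
    (y : ℕ → EuclideanSpace ℝ (Fin p)) (m : EuclideanSpace ℝ (Fin p) → ℕ → ℝ) : ℝ :=
  ∫ t : EuclideanSpace ℝ (Fin p),
    ‖ecf p n x t - (if estVar p n x t < k then cvChf H y t (m t) else mcChf H y t)‖ ^ 2
      * (w t / estVar p n x t)

end Simulated

section Model

variable {Ω' Θ : Type*} [MeasurableSpace Ω']

/-- The first block `𝐗_1(θ) = (X_1(θ), …, X_p(θ))` of the model process at the parameter `θ`. -/
noncomputable def modelBlock (p : ℕ) (Y : ℤ → Θ → Ω' → ℝ) (θ : Θ) (ω : Ω') :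
    EuclideanSpace ℝ (Fin p) :=
  block p (fun i => Y i θ ω) 1

/-- The characteristic function `φ(t, θ) = E exp(i⟨t, 𝐗_1(θ)⟩)`. -/
noncomputable def modelChf (p : ℕ) (P' : Measure Ω') (Y : ℤ → Θ → Ω' → ℝ)
    (t : EuclideanSpace ℝ (Fin p)) (θ : Θ) : ℂ :=
  ∫ ω, expChar t (modelBlock p Y θ ω) ∂P'

/-- The moment `E ⟨t, 𝐗_1(θ)⟩^ν`. -/
noncomputable def modelMoment (p : ℕ) (P' : Measure Ω') (Y : ℤ → Θ → Ω' → ℝ) (θ : Θ)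
    (t : EuclideanSpace ℝ (Fin p)) (ν : ℕ) : ℝ :=
  ∫ ω, (inner ℝ t (modelBlock p Y θ ω) : ℝ) ^ ν ∂P'

end Model

/-- `θhat n` is the argmin of `Q n` over all parameters: it is a minimizer whenever `Q n` has one
(whichever one, if there are several). -/
def IsArgminSeq {Θ : Type*} (Q : ℕ → Θ → ℝ) (θhat : ℕ → Θ) : Prop :=
  ∀ n, (∃ θ, ∀ θ', Q n θ ≤ Q n θ') → ∀ θ', Q n (θhat n) ≤ Q n θ'

end CFEst

/-!
The proof is an argmin argument along almost every realization of the data and the simulations.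

*Data.* The empirical characteristic function and the sample autocovariances are averages along the
shift, so they converge by the pointwise ergodic theorem (`CFEst.ae_tendsto_birkhoffAverage`, proved
through running maxima of Birkhoff sums). The limit of the estimated variance of `⟨t, 𝐗_1⟩` is a
positive definite quadratic form in `t`, by nondegeneracy at the true parameter; hence eventually
the estimated variance is at least `c ‖t‖²` for all `t` at once (`CFEst.eventually_le_estVar`), and
`w(t) / ‖t‖²` dominates the weights.

*Simulations.* Since the simulated blocks are continuous in the parameter, the strong law of large
numbers in the Banach space of continuous functions on a compact space gives almost sure uniform
convergence of their averages (`CFEst.ae_tendstoUniformly_average`). It yields the convergence of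
the Monte Carlo characteristic functions, uniformly in the parameter.

*Control variates.* The correction `β̂ᵀ P_H(h)` is unchanged when `t` is rescaled inside the control
functions only (`CFEst.correction_scale`), so it can be estimated on the unit sphere, a compact set.
There the uniform strong law applies to the moments of order up to four, and the determinant of the
empirical covariance matrix of the control functions stays bounded away from zero because its limit
is positive by nondegeneracy (`CFEst.momentDet_pos`). Consequently the correction tends to zero
uniformly in the parameter and in `t ≠ 0` (`CFEst.eventually_norm_kappa_le`), and is eventually
continuous in the parameter.

*Conclusion.* The criterion is eventually continuous, hence has minimizers, and by dominated
convergence it converges continuously to `∫ |φ(t, θ₀) - φ(t, θ)|² w(t) / V(t) dt`, with `V` the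
limit of the estimated variance. As `w > 0` almost everywhere, identifiability makes `θ₀` the only
zero of the limit, and every cluster point of the minimizers is such a zero
(`CFEst.tendsto_argmin`).
-/

namespace CFEst

/-! ### The pointwise ergodic theorem -/

section Birkhoff

variable {α : Type*} {T : α → α} {f : α → ℝ}

/-- The running maximum `max_{0 ≤ k ≤ n} S_k` of the Birkhoff sums `S_k` of `f` (with `S_0 = 0`),
given by the recursion `M_{n+1} = max (0, f + M_n ∘ T)`. -/
noncomputable def birkhoffMax (T : α → α) (f : α → ℝ) : ℕ → α → ℝ
  | 0 => fun _ => 0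
  | n + 1 => fun x => max 0 (f x + birkhoffMax T f n (T x))

lemma birkhoffMax_nonneg (n : ℕ) (x : α) : 0 ≤ birkhoffMax T f n x := by
  cases n with
  | zero => exact le_rfl
  | succ n => exact le_max_left _ _

lemma birkhoffMax_le_succ (n : ℕ) (x : α) : birkhoffMax T f n x ≤ birkhoffMax T f (n + 1) x := by
  induction n generalizing x with
  | zero => exact le_max_left _ _
  | succ n ih => exact max_le_max le_rfl (add_le_add le_rfl (ih (T x)))

lemma birkhoffMax_mono (x : α) : Monotone fun n => birkhoffMax T f n x :=
  monotone_nat_of_le_succ fun n => birkhoffMax_le_succ n x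

lemma birkhoffSum_le_birkhoffMax (n : ℕ) (x : α) : birkhoffSum T f n x ≤ birkhoffMax T f n x := by
  induction n generalizing x with
  | zero => simp [birkhoffMax]
  | succ n ih =>
    rw [birkhoffSum_succ']
    exact (add_le_add le_rfl (ih (T x))).trans (le_max_right _ _)

variable [MeasurableSpace α] {μ : Measure α}

lemma measurable_birkhoffMax (hT : Measurable T) (hf : Measurable f) (n : ℕ) :
    Measurable (birkhoffMax T f n) := by
  induction n with
  | zero => exact measurable_const
  | succ n ih => exact measurable_const.max (hf.add (ih.comp hT))

lemma integrable_birkhoffMax (hT : MeasurePreserving T μ μ) (hf : Integrable f μ) (n : ℕ) :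
    Integrable (birkhoffMax T f n) μ := by
  induction n with
  | zero => exact integrable_zero _ _ _
  | succ n ih =>
    exact (integrable_zero _ _ _).sup (hf.add (hT.integrable_comp_of_integrable ih))

/-- Under an ergodic map, the Birkhoff sums of a function of negative mean are almost surely
bounded above. Otherwise the running maxima `M_n` tend to infinity almost surely, so
`M_{n+1} - M_n ∘ T = max (-M_n ∘ T, f)` tends to `f`, although its integral is nonnegative. -/
lemma ae_bddAbove_birkhoffSum [IsProbabilityMeasure μ] (hT : Ergodic T μ) (hfm : Measurable f)
    (hf : Integrable f μ) (hneg : ∫ x, f x ∂μ < 0) :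
    ∀ᵐ x ∂μ, BddAbove (Set.range fun n => birkhoffSum T f n x) := by
  set M := birkhoffMax T f with hM
  have hMm : ∀ n, Measurable (M n) := measurable_birkhoffMax hT.measurable hfm
  have hMi : ∀ n, Integrable (M n) μ := integrable_birkhoffMax hT.toMeasurePreserving hf
  let A : Set α := {x | ∃ N : ℕ, ∀ n, M n x ≤ N}
  have hAm : MeasurableSet A := by
    have : A = ⋃ N : ℕ, ⋂ n, {x | M n x ≤ N} := by ext; simp [A]
    rw [this]
    exact MeasurableSet.iUnion fun N => MeasurableSet.iInter fun n =>
      measurableSet_le (hMm n) measurable_const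
  have hAinv : T ⁻¹' A = A := by
    ext x
    constructor
    · rintro ⟨N, hN⟩
      obtain ⟨N', hN'⟩ := exists_nat_ge (max 0 (f x + N))
      refine ⟨N', fun n => ((birkhoffMax_le_succ n x).trans ?_).trans hN'⟩
      exact max_le_max le_rfl (add_le_add le_rfl (hN n))
    · rintro ⟨N, hN⟩
      obtain ⟨N', hN'⟩ := exists_nat_ge (N - f x)
      refine ⟨N', fun n => le_trans ?_ hN'⟩
      have h1 := hN (n + 1)
      have h2 : f x + M n (T x) ≤ M (n + 1) x := le_max_right _ _
      linarith
  have hAfull : ∀ᵐ x ∂μ, x ∈ A := by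
    rcases hT.toPreErgodic.ae_mem_or_ae_notMem hAm hAinv with h | h
    · exact h
    exfalso
    have hlim : ∀ᵐ x ∂μ, Tendsto (fun n => M (n + 1) x - M n (T x)) atTop (𝓝 (f x)) := by
      filter_upwards [h] with x hx
      have hTx : T x ∉ A := fun hc => hx (by rwa [← hAinv])
      have htop : Tendsto (fun n => M n (T x)) atTop atTop := by
        refine tendsto_atTop_atTop_of_monotone (birkhoffMax_mono _) fun b => ?_
        by_contra! hcon
        obtain ⟨N, hN⟩ := exists_nat_ge b
        exact hTx ⟨N, fun n => (hcon n).le.trans hN⟩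
      refine tendsto_const_nhds.congr' ?_
      filter_upwards [htop.eventually_ge_atTop (-f x)] with n hn
      have : M (n + 1) x = f x + M n (T x) := max_eq_right (by linarith)
      linarith
    have hbound : ∀ n, ∀ᵐ x ∂μ, ‖M (n + 1) x - M n (T x)‖ ≤ ‖f x‖ := by
      refine fun n => ae_of_all _ fun x => ?_
      have h0 : 0 ≤ M n (T x) := birkhoffMax_nonneg _ _
      have h1 : M (n + 1) x = max 0 (f x + M n (T x)) := rfl
      rw [Real.norm_eq_abs, Real.norm_eq_abs, abs_le]
      have := neg_abs_le (f x)
      have := le_abs_self (f x)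
      rcases max_cases 0 (f x + M n (T x)) with hc | hc <;> constructor <;>
        linarith [abs_nonneg (f x)]
    have hint := tendsto_integral_of_dominated_convergence (fun x => ‖f x‖)
      (fun n => ((hMm (n + 1)).sub ((hMm n).comp hT.measurable)).aestronglyMeasurable)
      hf.norm hbound hlim
    refine absurd (ge_of_tendsto' hint fun n => ?_) (not_le.2 hneg)
    have hcomp : ∫ x, M n (T x) ∂μ = ∫ x, M n x ∂μ := by
      conv_rhs => rw [← hT.toMeasurePreserving.map_eq]
      rw [integral_map hT.measurable.aemeasurable (hMm n).aestronglyMeasurable]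
    have hsub : ∫ x, (M (n + 1) x - M n (T x)) ∂μ = ∫ x, M (n + 1) x ∂μ - ∫ x, M n (T x) ∂μ :=
      integral_sub (hMi (n + 1)) (hT.toMeasurePreserving.integrable_comp_of_integrable (hMi n))
    show 0 ≤ ∫ x, (M (n + 1) x - M n (T x)) ∂μ
    rw [hsub, hcomp, sub_nonneg]
    exact integral_mono (hMi n) (hMi (n + 1)) fun x => birkhoffMax_le_succ n x
  filter_upwards [hAfull] with x hx
  obtain ⟨N, hN⟩ := hx
  refine ⟨N, ?_⟩
  rintro _ ⟨n, rfl⟩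
  exact (birkhoffSum_le_birkhoffMax n x).trans (hN n)

/-- The upper half of the ergodic theorem: `ae_bddAbove_birkhoffSum` is applied to `f - ∫ f - ε`. -/
lemma ae_eventually_birkhoffAverage_lt [IsProbabilityMeasure μ] (hT : Ergodic T μ)
    (hfm : Measurable f) (hf : Integrable f μ) :
    ∀ᵐ x ∂μ, ∀ a > ∫ x, f x ∂μ, ∀ᶠ n in atTop, birkhoffAverage ℝ T f n x < a := by
  have key : ∀ m : ℕ, ∀ᵐ x ∂μ, BddAbove (Set.range fun n =>
      birkhoffSum T (fun y => f y - (∫ x, f x ∂μ + 1 / ((m : ℝ) + 1))) n x) := by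
    intro m
    refine ae_bddAbove_birkhoffSum hT (hfm.sub measurable_const)
      (hf.sub (integrable_const _)) ?_
    rw [integral_sub hf (integrable_const _)]
    simp only [integral_const, probReal_univ, one_smul]
    have : 0 < 1 / ((m : ℝ) + 1) := Nat.one_div_pos_of_nat
    linarith
  filter_upwards [ae_all_iff.2 key] with x hx a ha
  obtain ⟨m, hm⟩ := exists_nat_one_div_lt (sub_pos.2 ha)
  obtain ⟨C, hC⟩ := hx m
  have hlim : Tendsto (fun n : ℕ => (∫ x, f x ∂μ + 1 / ((m : ℝ) + 1)) + C / (n : ℝ)) atTop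
      (𝓝 ((∫ x, f x ∂μ + 1 / ((m : ℝ) + 1)) + 0)) :=
    tendsto_const_nhds.add (tendsto_const_div_atTop_nhds_zero_nat C)
  filter_upwards [hlim.eventually_lt_const (u := a) (by linarith), eventually_gt_atTop 0]
    with n hn hn0
  refine lt_of_le_of_lt ?_ hn
  have h1 := hC ⟨n, rfl⟩
  have hn0' : (0 : ℝ) < n := by exact_mod_cast hn0
  simp only [birkhoffSum, Finset.sum_sub_distrib, Finset.sum_const, Finset.card_range,
    nsmul_eq_mul] at h1
  simp only [birkhoffAverage, birkhoffSum, smul_eq_mul]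
  rw [inv_mul_le_iff₀ hn0', mul_add, mul_div_cancel₀ _ hn0'.ne']
  linarith

/-- The pointwise ergodic theorem of Birkhoff, for an ergodic probability-preserving map. -/
theorem ae_tendsto_birkhoffAverage [IsProbabilityMeasure μ] (hT : Ergodic T μ)
    (hfm : Measurable f) (hf : Integrable f μ) :
    ∀ᵐ x ∂μ, Tendsto (fun n => birkhoffAverage ℝ T f n x) atTop (𝓝 (∫ x, f x ∂μ)) := by
  filter_upwards [ae_eventually_birkhoffAverage_lt hT hfm hf,
    ae_eventually_birkhoffAverage_lt hT hfm.neg hf.neg] with x h1 h2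
  refine tendsto_order.2 ⟨fun a ha => ?_, fun a ha => h1 a ha⟩
  have h3 := h2 (-a) (by simp only [Pi.neg_apply, integral_neg]; linarith)
  filter_upwards [h3] with n hn
  have : birkhoffAverage ℝ T (-f) n x = - birkhoffAverage ℝ T f n x := by
    simp [birkhoffAverage, birkhoffSum]
  linarith

end Birkhoff

/-! ### A uniform strong law of large numbers -/

section UniformLaw

variable {K F : Type*} [TopologicalSpace K] [CompactSpace K] [SecondCountableTopology K]
  [NormedAddCommGroup F] [SecondCountableTopology F]
  [MeasurableSpace F] [BorelSpace F]

/-- Sampling a continuous function along a dense sequence is a Borel isomorphism onto its range,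
by the theorem of Lusin and Souslin. -/
lemma measurableEmbedding_sample [CompleteSpace F] [Nonempty K] [LocallyCompactSpace K]
    [MeasurableSpace C(K, F)] [BorelSpace C(K, F)] :
    MeasurableEmbedding fun (g : C(K, F)) (n : ℕ) => g (TopologicalSpace.denseSeq K n) := by
  have : PolishSpace C(K, F) := inferInstance
  have : StandardBorelSpace C(K, F) := inferInstance
  refine Measurable.measurableEmbedding ?_ ?_
  · exact measurable_pi_lambda _ fun n => (continuous_eval_const _).measurable
  · intro g₁ g₂ h
    exact DFunLike.coe_injective ((TopologicalSpace.denseRange_denseSeq K).equalizer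
      g₁.continuous g₂.continuous (by simpa [Function.comp_def] using h))

variable [NormedSpace ℝ F] [CompleteSpace F] [LocallyCompactSpace K]

/-- The strong law of large numbers for random continuous functions on a compact space, uniformly
over that space. It is the strong law in the Banach space of continuous functions. -/
theorem ae_tendstoUniformly_average [Nonempty K] {Ω : Type*} [MeasurableSpace Ω] {P : Measure Ω}
    (A : ℕ → Ω → C(K, F))
    (hmeas : ∀ j x, Measurable fun ω => A j ω x)
    (hident : ∀ j, IdentDistrib (fun ω x => A j ω x) (fun ω x => A 0 ω x) P P)
    (hindep : Pairwise fun i j => IndepFun (fun ω x => A i ω x) (fun ω x => A j ω x) P)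
    (hint : ∫⁻ ω, ‖A 0 ω‖ₑ ∂P < ⊤) :
    ∀ᵐ ω ∂P, TendstoUniformly (fun (n : ℕ) x => (n : ℝ)⁻¹ • ∑ j ∈ Finset.range n, A j ω x)
      (fun x => ∫ ω, A 0 ω x ∂P) atTop := by
  let _ : MeasurableSpace C(K, F) := borel _
  have : BorelSpace C(K, F) := ⟨rfl⟩
  have he := measurableEmbedding_sample (K := K) (F := F)
  set e : C(K, F) → ℕ → F := fun g n => g (TopologicalSpace.denseSeq K n) with he_def
  have hres : Measurable fun (g : K → F) (n : ℕ) => g (TopologicalSpace.denseSeq K n) :=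
    measurable_pi_lambda _ fun n => measurable_pi_apply _
  have hA : ∀ j, Measurable (A j) := fun j =>
    he.measurable_comp_iff.1 (measurable_pi_lambda _ fun n => hmeas j _)
  have hi : Integrable (A 0) P := ⟨(hA 0).aestronglyMeasurable, hint⟩
  have hid : ∀ j, IdentDistrib (A j) (A 0) P P := by
    intro j
    refine ⟨(hA j).aemeasurable, (hA 0).aemeasurable, ?_⟩
    have h1 := ((hident j).comp hres).map_eq
    have h2 : ∀ i, P.map (A i) = (P.map fun ω => e (A i ω)).comap e := by
      intro i
      have h3 : P.map (fun ω => e (A i ω)) = (P.map (A i)).map e :=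
        (Measure.map_map he.measurable (hA i)).symm
      rw [h3, he.comap_map]
    rw [h2 j, h2 0]
    exact congrArg _ h1
  have hin : Pairwise fun i j => IndepFun (A i) (A j) P := by
    intro i j hij
    have h1 := (hindep hij).comp hres hres
    rw [IndepFun_iff_Indep] at h1 ⊢
    have h2 : ∀ i, MeasurableSpace.comap (A i) (borel C(K, F))
        = MeasurableSpace.comap (fun ω => e (A i ω)) inferInstance := by
      intro i
      have h3 : borel C(K, F) = MeasurableSpace.comap e inferInstance := he.comap_eq.symm
      rw [h3, MeasurableSpace.comap_comp]
      rfl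
    rw [h2 i, h2 j]
    exact h1
  filter_upwards [strong_law_ae A hi hin hid] with ω hω
  have h := ContinuousMap.tendsto_iff_tendstoUniformly.1 hω
  convert h using 2 with n x
  · funext x
    simp
  · exact ((ContinuousMap.evalCLM ℝ x).integral_comp_comm hi)

end UniformLaw

/-! ### Limits of the sample statistics of the observed series -/

section Data

lemma measurable_block (p : ℕ) (j : ℤ) : Measurable fun x : ℤ → ℝ => block p x j :=
  (MeasurableEquiv.toLp 2 (Fin p → ℝ)).measurable.comp
    (measurable_pi_lambda _ fun _ => measurable_pi_apply _)

lemma measurable_expChar_block (p : ℕ) (j : ℤ) :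
    Measurable fun z : (ℤ → ℝ) × EuclideanSpace ℝ (Fin p) => expChar z.2 (block p z.1 j) := by
  have h : Measurable fun z : (ℤ → ℝ) × EuclideanSpace ℝ (Fin p) => block p z.1 j :=
    (measurable_block p j).comp measurable_fst
  unfold expChar
  fun_prop

lemma norm_expChar {p : ℕ} (t x : EuclideanSpace ℝ (Fin p)) : ‖expChar t x‖ = 1 := by
  rw [expChar, mul_comm]
  exact Complex.norm_exp_ofReal_mul_I _

lemma shift_iterate (n : ℕ) (x : ℤ → ℝ) : shift^[n] x = fun i => x (i + n) := by
  induction n generalizing x with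
  | zero => simp
  | succ n ih =>
    rw [Function.iterate_succ_apply, ih]
    funext i
    simp only [shift]
    push_cast
    ring_nf

variable {μ : Measure (ℤ → ℝ)}

lemma ae_tendsto_average [IsProbabilityMeasure μ] (hμ : Ergodic shift μ)
    {g : (ℤ → ℝ) → ℝ} (hgm : Measurable g) (hg : Integrable g μ) :
    ∀ᵐ x ∂μ, Tendsto (fun n : ℕ => (1 / (n : ℝ)) * ∑ j ∈ Finset.range n, g fun i => x (i + j))
      atTop (𝓝 (∫ x, g x ∂μ)) := by
  filter_upwards [ae_tendsto_birkhoffAverage hμ hgm hg] with x hx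
  refine hx.congr fun n => ?_
  simp [birkhoffAverage, birkhoffSum, shift_iterate]

lemma integral_shift (hμ : Ergodic shift μ) (g : (ℤ → ℝ) → ℝ) (hg : Measurable g) (n : ℕ) :
    ∫ x, g (fun i => x (i + n)) ∂μ = ∫ x, g x ∂μ := by
  have h := hμ.toMeasurePreserving.iterate n
  conv_rhs => rw [← h.map_eq]
  rw [integral_map h.measurable.aemeasurable hg.aestronglyMeasurable]
  simp [shift_iterate]

lemma memLp_coord (hμ : Ergodic shift μ) (h2 : MemLp (fun x : ℤ → ℝ => x 1) 2 μ) (n : ℕ) :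
    MemLp (fun x : ℤ → ℝ => x (1 + n)) 2 μ := by
  have h := h2.comp_measurePreserving (hμ.toMeasurePreserving.iterate n)
  simpa [Function.comp_def, shift_iterate] using h

/-- The autocovariance at lag `h` of a stationary law on sequence space. -/
noncomputable def autocov (μ : Measure (ℤ → ℝ)) (h : ℕ) : ℝ :=
  ∫ x, x 1 * x (1 + h) ∂μ - (∫ x, x 1 ∂μ) ^ 2

lemma ae_tendsto_sampleAutocov [IsProbabilityMeasure μ] (hμ : Ergodic shift μ)
    (h2 : MemLp (fun x : ℤ → ℝ => x 1) 2 μ) (h : ℕ) :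
    ∀ᵐ x ∂μ, Tendsto (fun n => sampleAutocov n x h) atTop (𝓝 (autocov μ h)) := by
  have hi : ∀ n : ℕ, Integrable (fun x : ℤ → ℝ => x (1 + n)) μ := fun n =>
    (memLp_coord hμ h2 n).integrable (by norm_num)
  have h1 := ae_tendsto_average hμ (measurable_pi_apply (1 : ℤ)) (h2.integrable (by norm_num))
  have h1h := ae_tendsto_average hμ (measurable_pi_apply (1 + h : ℤ)) (hi h)
  have hpr := ae_tendsto_average hμ (g := fun x => x 1 * x (1 + h))
    ((measurable_pi_apply (1 : ℤ)).mul (measurable_pi_apply (1 + h : ℤ)))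
    (h2.integrable_mul (memLp_coord hμ h2 h))
  have hmean : ∫ x, x (1 + (h : ℤ)) ∂μ = ∫ x, x 1 ∂μ :=
    integral_shift hμ (fun x => x 1) (measurable_pi_apply _) h
  filter_upwards [h1, h1h, hpr] with x h1 h1h hpr
  have hsub : Tendsto (fun n : ℕ => n - h) atTop atTop := tendsto_sub_atTop_nat h
  have hm : Tendsto (fun n => sampleMean n x) atTop (𝓝 (∫ x, x 1 ∂μ)) := by
    refine h1.congr fun n => ?_
    simp [sampleMean, add_comm]
  have hlim := ((hpr.comp hsub).sub (hm.mul (h1.comp hsub))).sub (hm.mul (h1h.comp hsub))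
    |>.add (hm.mul hm)
  rw [hmean] at hlim
  have hval : autocov μ h = ∫ x, x 1 * x (1 + h) ∂μ - (∫ x, x 1 ∂μ) * (∫ x, x 1 ∂μ)
      - (∫ x, x 1 ∂μ) * (∫ x, x 1 ∂μ) + (∫ x, x 1 ∂μ) * (∫ x, x 1 ∂μ) := by
    rw [autocov]; ring
  rw [hval]
  refine hlim.congr' ?_
  filter_upwards [eventually_gt_atTop h] with n hn
  have hpos : (0 : ℝ) < ((n - h : ℕ) : ℝ) := by exact_mod_cast Nat.sub_pos_of_lt hn
  have hcast : (n : ℝ) - h = ((n - h : ℕ) : ℝ) := by rw [Nat.cast_sub hn.le]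
  simp only [Function.comp_apply, sampleAutocov, hcast]
  have hexp : ∀ j : ℕ, (x ((j : ℤ) + 1) - sampleMean n x) * (x ((j : ℤ) + 1 + h) - sampleMean n x)
      = x (1 + j) * x (1 + h + j) - sampleMean n x * x (1 + j) - sampleMean n x * x (1 + h + j)
        + sampleMean n x * sampleMean n x := by
    intro j
    rw [show (j : ℤ) + 1 = 1 + j by ring, show (1 : ℤ) + j + h = 1 + h + j by ring]
    ring
  simp only [hexp, Finset.sum_add_distrib, Finset.sum_sub_distrib, ← Finset.mul_sum,
    Finset.sum_const, Finset.card_range, nsmul_eq_mul]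
  field_simp

lemma ae_tendsto_ecf_apply [IsProbabilityMeasure μ] (hμ : Ergodic shift μ) {p : ℕ}
    (t : EuclideanSpace ℝ (Fin p)) :
    ∀ᵐ x ∂μ, Tendsto (fun n => ecf p n x t) atTop (𝓝 (∫ x, expChar t (block p x 1) ∂μ)) := by
  have hgm : Measurable fun x : ℤ → ℝ => expChar t (block p x 1) := by
    have := measurable_block p 1
    unfold expChar
    fun_prop
  have hgi : Integrable (fun x : ℤ → ℝ => expChar t (block p x 1)) μ :=
    Integrable.of_bound hgm.aestronglyMeasurable 1 (ae_of_all _ fun x => (norm_expChar _ _).le)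
  have hre := ae_tendsto_average hμ (g := fun x => (expChar t (block p x 1)).re)
    (Complex.measurable_re.comp hgm) hgi.re
  have him := ae_tendsto_average hμ (g := fun x => (expChar t (block p x 1)).im)
    (Complex.measurable_im.comp hgm) hgi.im
  filter_upwards [hre, him] with x hre him
  have hbl : ∀ j : ℕ, block p x ((j : ℤ) + 1) = block p (fun i => x (i + j)) 1 := by
    intro j
    simp only [block]
    congr 1
    funext i
    ring_nf
  have h := hre.ofReal.add (him.ofReal.mul_const Complex.I)
  have hlim : ∫ x, expChar t (block p x 1) ∂μ =
      ((∫ x, (expChar t (block p x 1)).re ∂μ : ℝ) : ℂ)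
        + ((∫ x, (expChar t (block p x 1)).im ∂μ : ℝ) : ℂ) * Complex.I :=
    (integral_re_add_im hgi).symm
  have heq : ∀ n, ecf p n x t =
      (((1 / (n : ℝ)) * ∑ j ∈ Finset.range n,
        (expChar t (block p (fun i => x (i + j)) 1)).re : ℝ) : ℂ)
      + (((1 / (n : ℝ)) * ∑ j ∈ Finset.range n,
        (expChar t (block p (fun i => x (i + j)) 1)).im : ℝ) : ℂ) * Complex.I := by
    intro n
    apply Complex.ext <;> simp [ecf, hbl, ← Complex.ofReal_natCast, ← Complex.ofReal_inv]
  simp_rw [heq, hlim]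
  exact h

/-- For almost every path, the empirical characteristic function converges at almost every point;
the exceptional sets are exchanged by Fubini's theorem. -/
lemma ae_tendsto_ecf [IsProbabilityMeasure μ] (hμ : Ergodic shift μ) (p : ℕ) :
    ∀ᵐ x ∂μ, ∀ᵐ t : EuclideanSpace ℝ (Fin p), Tendsto (fun n => ecf p n x t) atTop
      (𝓝 (∫ x, expChar t (block p x 1) ∂μ)) := by
  have hjoint := measurable_expChar_block p
  have hecf : ∀ n, Measurable fun z : (ℤ → ℝ) × EuclideanSpace ℝ (Fin p) => ecf p n z.1 z.2 :=
    fun n => measurable_const.mul (Finset.measurable_fun_sum _ fun j _ => hjoint _)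
  have hchf : Measurable fun z : (ℤ → ℝ) × EuclideanSpace ℝ (Fin p) =>
      ∫ x, expChar z.2 (block p x 1) ∂μ :=
    ((hjoint 1).comp measurable_swap).stronglyMeasurable.integral_prod_right'
      (ν := μ).measurable.comp measurable_snd
  have hset : MeasurableSet {z : (ℤ → ℝ) × EuclideanSpace ℝ (Fin p) |
      Tendsto (fun n => ecf p n z.1 z.2) atTop (𝓝 (∫ x, expChar z.2 (block p x 1) ∂μ))} :=
    measurableSet_tendsto_fun hecf hchf
  have hcomm := Measure.ae_ae_comm (μ := μ) (ν := (volume : Measure (EuclideanSpace ℝ (Fin p))))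
    (p := fun x t => Tendsto (fun n => ecf p n x t) atTop
      (𝓝 (∫ x, expChar t (block p x 1) ∂μ))) hset
  rw [hcomm]
  exact ae_of_all _ fun t => ae_tendsto_ecf_apply hμ t

/-! ### The estimated variance -/

/-- The variance of `⟨t, (x_1, …, x_p)⟩` under a stationary law, as the quadratic form of the
Toeplitz matrix of autocovariances. -/
noncomputable def blockVar (μ : Measure (ℤ → ℝ)) (p : ℕ) (t : EuclideanSpace ℝ (Fin p)) : ℝ :=
  ∑ i : Fin p, ∑ j : Fin p, t i * autocov μ ((i : ℤ) - (j : ℤ)).natAbs * t j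

lemma estVar_eq_sum (p n : ℕ) (x : ℤ → ℝ) (t : EuclideanSpace ℝ (Fin p)) :
    estVar p n x t = ∑ i : Fin p, ∑ j : Fin p,
      t i * sampleAutocov n x ((i : ℤ) - (j : ℤ)).natAbs * t j := by
  simp only [estVar, dotProduct, Matrix.mulVec, sampleCovMatrix, Matrix.of_apply,
    Finset.mul_sum, mul_assoc]

lemma inner_block {p : ℕ} (t : EuclideanSpace ℝ (Fin p)) (x : ℤ → ℝ) :
    (inner ℝ t (block p x 1) : ℝ) = ∑ i, t i * x (1 + (i : ℕ)) := by
  simp [PiLp.inner_apply, block, mul_comm]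

lemma integral_coord_mul_coord (hμ : Ergodic shift μ) (i j : ℕ) :
    ∫ x, x (1 + (i : ℤ)) * x (1 + (j : ℤ)) ∂μ
      = ∫ x, x 1 * x (1 + (((i : ℤ) - (j : ℤ)).natAbs : ℤ)) ∂μ := by
  have key : ∀ a d : ℕ, ∫ x, x (1 + (a : ℤ)) * x (1 + (d : ℤ) + a) ∂μ
      = ∫ x, x 1 * x (1 + (d : ℤ)) ∂μ := fun a d =>
    integral_shift hμ (fun x => x 1 * x (1 + (d : ℤ)))
      ((measurable_pi_apply _).mul (measurable_pi_apply _)) a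
  rcases le_total i j with h | h
  · have e : (1 : ℤ) + (j : ℤ) = 1 + (((i : ℤ) - (j : ℤ)).natAbs : ℤ) + i := by omega
    rw [e, key]
  · have e : (1 : ℤ) + (i : ℤ) = 1 + (((i : ℤ) - (j : ℤ)).natAbs : ℤ) + j := by omega
    rw [← key j, ← e]
    exact integral_congr_ae (ae_of_all _ fun x => mul_comm _ _)

lemma blockVar_eq_integral [IsProbabilityMeasure μ] (hμ : Ergodic shift μ)
    (h2 : MemLp (fun x : ℤ → ℝ => x 1) 2 μ) {p : ℕ}
    (t : EuclideanSpace ℝ (Fin p)) :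
    blockVar μ p t = ∫ x, ((inner ℝ t (block p x 1) : ℝ)
      - ∫ x', (inner ℝ t (block p x' 1) : ℝ) ∂μ) ^ 2 ∂μ := by
  have hc := memLp_coord hμ h2
  have hmean : ∫ x', (inner ℝ t (block p x' 1) : ℝ) ∂μ = ∑ i, t i * ∫ x, x 1 ∂μ := by
    simp only [inner_block]
    rw [integral_finsetSum (f := fun (i : Fin p) (x : ℤ → ℝ) => t i * x (1 + (i : ℕ))) _
      fun i _ => ((hc i).integrable (by norm_num)).const_mul _]
    refine Finset.sum_congr rfl fun i _ => ?_
    rw [integral_const_mul]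
    congr 1
    exact integral_shift hμ (fun x => x 1) (measurable_pi_apply _) i
  set m := ∫ x : ℤ → ℝ, x 1 ∂μ with hm
  have hsq : ∀ x : ℤ → ℝ, ((inner ℝ t (block p x 1) : ℝ) - ∑ i, t i * m) ^ 2
      = ∑ i : Fin p, ∑ j : Fin p, t i * t j * ((x (1 + (i : ℕ)) - m) * (x (1 + (j : ℕ)) - m)) := by
    intro x
    rw [inner_block, ← Finset.sum_sub_distrib, sq, Finset.sum_mul_sum]
    refine Finset.sum_congr rfl fun i _ => Finset.sum_congr rfl fun j _ => ?_
    ring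
  have hcm : ∀ i : ℕ, MemLp (fun x : ℤ → ℝ => x (1 + i) - m) 2 μ := fun i =>
    (hc i).sub (memLp_const m)
  have hii : ∀ i j : ℕ, Integrable (fun x : ℤ → ℝ => (x (1 + i) - m) * (x (1 + j) - m)) μ :=
    fun i j => (hcm i).integrable_mul (hcm j)
  simp only [hmean, hsq, blockVar]
  rw [integral_finsetSum (f := fun (i : Fin p) (x : ℤ → ℝ) => ∑ j : Fin p,
    t i * t j * ((x (1 + (i : ℕ)) - m) * (x (1 + (j : ℕ)) - m))) _
    fun i _ => integrable_finsetSum _ fun j _ => (hii i j).const_mul _]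
  refine Finset.sum_congr rfl fun i _ => ?_
  rw [integral_finsetSum (f := fun (j : Fin p) (x : ℤ → ℝ) =>
    t i * t j * ((x (1 + (i : ℕ)) - m) * (x (1 + (j : ℕ)) - m))) _
    fun j _ => (hii i j).const_mul _]
  refine Finset.sum_congr rfl fun j _ => ?_
  rw [integral_const_mul, autocov, ← integral_coord_mul_coord hμ i j]
  have e1 : ∀ k : ℕ, ∫ x : ℤ → ℝ, x (1 + (k : ℤ)) ∂μ = m := fun k =>
    integral_shift hμ (fun x => x 1) (measurable_pi_apply _) k
  have i1 : ∀ k : ℕ, Integrable (fun x : ℤ → ℝ => x (1 + (k : ℤ))) μ := fun k =>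
    (hc k).integrable (by norm_num)
  have i2 : Integrable (fun x : ℤ → ℝ => x (1 + (i : ℤ)) * x (1 + (j : ℤ))) μ :=
    (hc i).integrable_mul (hc j)
  have hex : ∫ x : ℤ → ℝ, (x (1 + (i : ℤ)) - m) * (x (1 + (j : ℤ)) - m) ∂μ
      = ∫ x : ℤ → ℝ, x (1 + (i : ℤ)) * x (1 + (j : ℤ)) ∂μ - m ^ 2 := by
    have : (fun x : ℤ → ℝ => (x (1 + (i : ℤ)) - m) * (x (1 + (j : ℤ)) - m)) = fun x =>
        x (1 + (i : ℤ)) * x (1 + (j : ℤ)) - m * x (1 + (i : ℤ)) - m * x (1 + (j : ℤ)) + m ^ 2 := by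
      funext x; ring
    have i3 : Integrable (fun x : ℤ → ℝ =>
        x (1 + (i : ℤ)) * x (1 + (j : ℤ)) - m * x (1 + (i : ℤ))) μ := i2.sub ((i1 i).const_mul m)
    have i4 : Integrable (fun x : ℤ → ℝ => x (1 + (i : ℤ)) * x (1 + (j : ℤ))
        - m * x (1 + (i : ℤ)) - m * x (1 + (j : ℤ))) μ := i3.sub ((i1 j).const_mul m)
    rw [this, integral_add i4 (integrable_const _), integral_sub i3 ((i1 j).const_mul m),
      integral_sub i2 ((i1 i).const_mul m), integral_const_mul, integral_const_mul, e1, e1]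
    simp
    ring
  rw [hex]
  ring

lemma blockVar_pos [IsProbabilityMeasure μ] (hμ : Ergodic shift μ)
    (h2 : MemLp (fun x : ℤ → ℝ => x 1) 2 μ) {p : ℕ}
    {t : EuclideanSpace ℝ (Fin p)}
    (hnc : ∀ c : ℝ, ¬ ∀ᵐ x ∂μ, (inner ℝ t (block p x 1) : ℝ) = c) :
    0 < blockVar μ p t := by
  rw [blockVar_eq_integral hμ h2]
  refine (integral_nonneg fun x => sq_nonneg _).lt_of_ne' fun h0 => ?_
  have hL : MemLp (fun x => (inner ℝ t (block p x 1) : ℝ)) 2 μ := by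
    simp only [inner_block]
    exact memLp_finsetSum _ fun i _ => (memLp_coord hμ h2 i).const_mul _
  have hi := (hL.sub (memLp_const (∫ x', (inner ℝ t (block p x' 1) : ℝ) ∂μ))).integrable_sq
  have h1 := (integral_eq_zero_iff_of_nonneg (fun x => sq_nonneg _) hi).1 h0
  refine hnc (∫ x', (inner ℝ t (block p x' 1) : ℝ) ∂μ) ?_
  filter_upwards [h1] with x hx
  simpa [sub_eq_zero] using hx

/-- A quadratic form that is positive off the origin dominates a multiple of the square norm. -/
lemma exists_pos_mul_norm_sq_le {p : ℕ} {a : Fin p → Fin p → ℝ}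
    (ha : ∀ t : EuclideanSpace ℝ (Fin p), t ≠ 0 → 0 < ∑ i : Fin p, ∑ j : Fin p, t i * a i j * t j) :
    ∃ c > 0, ∀ t : EuclideanSpace ℝ (Fin p),
      c * ‖t‖ ^ 2 ≤ ∑ i : Fin p, ∑ j : Fin p, t i * a i j * t j := by
  obtain ⟨c, hc0, hc⟩ := (isCompact_sphere (0 : EuclideanSpace ℝ (Fin p)) 1).exists_forall_le'
    (f := fun t => ∑ i : Fin p, ∑ j : Fin p, t i * a i j * t j) (a := 0) (by fun_prop)
    fun t ht => ha t (ne_zero_of_mem_unit_sphere ⟨t, ht⟩)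
  refine ⟨c, hc0, fun t => ?_⟩
  by_cases ht : t = 0
  · simp [ht]
  have hn : 0 < ‖t‖ := norm_pos_iff.2 ht
  have h1 := hc (‖t‖⁻¹ • t) (by simp [norm_smul, hn.ne'])
  have h2 : ∑ i : Fin p, ∑ j : Fin p, (‖t‖⁻¹ • t) i * a i j * (‖t‖⁻¹ • t) j
      = (‖t‖ ^ 2)⁻¹ * ∑ i : Fin p, ∑ j : Fin p, t i * a i j * t j := by
    simp only [PiLp.smul_apply, smul_eq_mul, Finset.mul_sum]
    refine Finset.sum_congr rfl fun i _ => Finset.sum_congr rfl fun j _ => ?_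
    field_simp
  rw [h2, le_inv_mul_iff₀ (by positivity)] at h1
  linarith

/-- The estimated variance is eventually bounded below by `c ‖t‖ ^ 2`, uniformly in `t`. -/
lemma eventually_le_estVar {p : ℕ} {x : ℤ → ℝ}
    (hpos : ∀ t : EuclideanSpace ℝ (Fin p), t ≠ 0 → 0 < blockVar μ p t)
    (hx : ∀ h, Tendsto (fun n => sampleAutocov n x h) atTop (𝓝 (autocov μ h))) :
    ∃ c > 0, ∀ᶠ n in atTop, ∀ t : EuclideanSpace ℝ (Fin p), c * ‖t‖ ^ 2 ≤ estVar p n x t := by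
  obtain ⟨c, hc0, hc⟩ := exists_pos_mul_norm_sq_le hpos
  have hlim : Tendsto (fun n => ∑ i : Fin p, ∑ j : Fin p,
      |sampleAutocov n x ((i : ℤ) - (j : ℤ)).natAbs - autocov μ ((i : ℤ) - (j : ℤ)).natAbs|)
      atTop (𝓝 0) := by
    have : (0 : ℝ) = ∑ i : Fin p, ∑ j : Fin p,
        |autocov μ ((i : ℤ) - (j : ℤ)).natAbs - autocov μ ((i : ℤ) - (j : ℤ)).natAbs| := by simp
    rw [this]
    exact tendsto_finsetSum _ fun i _ => tendsto_finsetSum _ fun j _ =>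
      ((hx _).sub_const _).abs
  refine ⟨c / 2, by positivity, ?_⟩
  filter_upwards [hlim.eventually_lt_const (u := c / 2) (by positivity)] with n hn t
  have hcoord : ∀ i, |t i| ≤ ‖t‖ := fun i => by
    simpa using PiLp.norm_apply_le t i
  have hdiff : |estVar p n x t - blockVar μ p t| ≤ c / 2 * ‖t‖ ^ 2 := by
    rw [estVar_eq_sum, blockVar, ← Finset.sum_sub_distrib]
    simp only [← Finset.sum_sub_distrib]
    refine le_trans ?_ (mul_le_mul_of_nonneg_right hn.le (sq_nonneg ‖t‖))
    rw [Finset.sum_mul]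
    refine (Finset.abs_sum_le_sum_abs _ _).trans (Finset.sum_le_sum fun i _ => ?_)
    rw [Finset.sum_mul]
    refine (Finset.abs_sum_le_sum_abs _ _).trans (Finset.sum_le_sum fun j _ => ?_)
    rw [← sub_mul, ← mul_sub, abs_mul, abs_mul, mul_comm |t i|, mul_assoc, sq]
    gcongr
    · exact hcoord i
    · exact hcoord j
  have := hc t
  have h3 := (abs_le.1 hdiff).1
  have h4 : blockVar μ p t = ∑ i : Fin p, ∑ j : Fin p,
    t i * autocov μ ((i : ℤ) - (j : ℤ)).natAbs * t j := rfl
  linarith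

lemma tendsto_estVar {p : ℕ} {x : ℤ → ℝ}
    (hx : ∀ h, Tendsto (fun n => sampleAutocov n x h) atTop (𝓝 (autocov μ h)))
    (t : EuclideanSpace ℝ (Fin p)) :
    Tendsto (fun n => estVar p n x t) atTop (𝓝 (blockVar μ p t)) := by
  simp only [estVar_eq_sum, blockVar]
  exact tendsto_finsetSum _ fun i _ => tendsto_finsetSum _ fun j _ =>
    ((hx _).const_mul _).mul_const _

end Data

/-! ### The control variates correction in terms of empirical moments -/

section Correction

variable {p : ℕ}

/-- The empirical moment `P_H(⟨t, ·⟩^ν)`. -/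
noncomputable def rawMoment (H : ℕ) (y : ℕ → EuclideanSpace ℝ (Fin p))
    (t : EuclideanSpace ℝ (Fin p)) (ν : ℕ) : ℝ :=
  (1 / (H : ℝ)) * ∑ j ∈ Finset.range H, (inner ℝ t (y j) : ℝ) ^ ν

/-- The empirical mixed moment `P_H(⟨u, ·⟩^ν f_t)`. -/
noncomputable def mixedMoment (H : ℕ) (y : ℕ → EuclideanSpace ℝ (Fin p))
    (t u : EuclideanSpace ℝ (Fin p)) (ν : ℕ) : ℂ :=
  (1 / (H : ℂ)) * ∑ j ∈ Finset.range H, ((inner ℝ u (y j) : ℝ) : ℂ) ^ ν * expChar t (y j)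

/-- The determinant of the covariance matrix of `U` and `U ^ 2`, where `M ν` is the `ν`-th moment
of `U`. -/
def momentDet (M : ℕ → ℝ) : ℝ :=
  (M 2 - M 1 ^ 2) * (M 4 - M 2 ^ 2) - (M 3 - M 1 * M 2) ^ 2

/-- The control variates correction as a function of the empirical moments `M ν` of `⟨t, ·⟩`, the
exact moments `m ν` and the mixed moments `C ν`, with the `2 × 2` matrix inverted by Cramer's
rule. -/
noncomputable def correction (M m : ℕ → ℝ) (C : ℕ → ℂ) : ℂ :=
  ((momentDet M : ℝ) : ℂ)⁻¹ *
    ((((M 4 - M 2 ^ 2 : ℝ) : ℂ) * (C 1 - M 1 * C 0)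
        - ((M 3 - M 1 * M 2 : ℝ) : ℂ) * (C 2 - M 2 * C 0)) * ((M 1 - m 1 : ℝ) : ℂ)
      + (((M 2 - M 1 ^ 2 : ℝ) : ℂ) * (C 2 - M 2 * C 0)
        - ((M 3 - M 1 * M 2 : ℝ) : ℂ) * (C 1 - M 1 * C 0)) * ((M 2 - m 2 : ℝ) : ℂ))

lemma empMean_sub_const {H : ℕ} (hH : H ≠ 0) (y : ℕ → EuclideanSpace ℝ (Fin p))
    (f : EuclideanSpace ℝ (Fin p) → ℂ) (c : ℂ) :
    empMean H y (fun x => f x - c) = empMean H y f - c := by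
  have : (H : ℂ) ≠ 0 := by exact_mod_cast hH
  simp only [empMean, Finset.sum_sub_distrib, Finset.sum_const, Finset.card_range, nsmul_eq_mul]
  field_simp

/-- Empirical covariances do not depend on the centring of the first function. -/
lemma empMean_cov_sub_const_left {H : ℕ} (hH : H ≠ 0) (y : ℕ → EuclideanSpace ℝ (Fin p))
    (f g : EuclideanSpace ℝ (Fin p) → ℂ) (c : ℂ) :
    empMean H y (fun x => (f x - c) * g x) - empMean H y (fun x => f x - c) * empMean H y g
      = empMean H y (fun x => f x * g x) - empMean H y f * empMean H y g := by
  rw [empMean_sub_const hH]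
  simp only [empMean, sub_mul, Finset.sum_sub_distrib, ← Finset.mul_sum]
  ring

lemma ctrl_eq (t : EuclideanSpace ℝ (Fin p)) (m : ℕ → ℝ) (ν : Fin 2) :
    ctrl t m ν = fun x => ((inner ℝ t x : ℝ) : ℂ) ^ ((ν : ℕ) + 1) - (m ((ν : ℕ) + 1) : ℂ) := by
  funext x
  simp [ctrl]

lemma empMean_inner_pow (H : ℕ) (y : ℕ → EuclideanSpace ℝ (Fin p))
    (t : EuclideanSpace ℝ (Fin p)) (ν : ℕ) :
    empMean H y (fun x => ((inner ℝ t x : ℝ) : ℂ) ^ ν) = rawMoment H y t ν := by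
  simp [empMean, rawMoment]

lemma ctrlCov_apply {H : ℕ} (hH : H ≠ 0) (y : ℕ → EuclideanSpace ℝ (Fin p))
    (t : EuclideanSpace ℝ (Fin p)) (m : ℕ → ℝ) (ν κ : Fin 2) :
    ctrlCov H y t m ν κ = ((rawMoment H y t ((ν : ℕ) + 1 + ((κ : ℕ) + 1))
      - rawMoment H y t ((ν : ℕ) + 1) * rawMoment H y t ((κ : ℕ) + 1) : ℝ) : ℂ) := by
  simp only [ctrlCov, Matrix.of_apply, ctrl_eq]
  rw [empMean_cov_sub_const_left hH]
  simp only [mul_comm (((inner ℝ t _ : ℝ) : ℂ) ^ ((ν : ℕ) + 1))]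
  rw [mul_comm (empMean H y fun x => ((inner ℝ t x : ℝ) : ℂ) ^ ((ν : ℕ) + 1)),
    empMean_cov_sub_const_left hH]
  simp only [← pow_add, empMean_inner_pow]
  push_cast
  rw [add_comm ((κ : ℕ) + 1), mul_comm]

lemma kappa_eq_correction {H : ℕ} (hH : H ≠ 0) (y : ℕ → EuclideanSpace ℝ (Fin p))
    (t : EuclideanSpace ℝ (Fin p)) (m : ℕ → ℝ) :
    kappa H y t m = correction (rawMoment H y t) m (mixedMoment H y t t) := by
  have hc : ∀ ν : ℕ, empMean H y (fun x => ((inner ℝ t x : ℝ) : ℂ) ^ ν * expChar t x)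
      = mixedMoment H y t t ν := fun ν => rfl
  have h0 : empMean H y (expChar t) = mixedMoment H y t t 0 := by simp [empMean, mixedMoment]
  have hv : (fun ν : Fin 2 => empMean H y (fun x => ctrl t m ν x * expChar t x)
      - empMean H y (ctrl t m ν) * empMean H y (expChar t)) = fun ν : Fin 2 =>
        mixedMoment H y t t ((ν : ℕ) + 1)
          - rawMoment H y t ((ν : ℕ) + 1) * mixedMoment H y t t 0 := by
    funext ν
    simp only [ctrl_eq]
    rw [empMean_cov_sub_const_left hH, hc, empMean_inner_pow, h0]
  have hδ : ∀ ν : Fin 2, empMean H y (ctrl t m ν)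
      = ((rawMoment H y t ((ν : ℕ) + 1) - m ((ν : ℕ) + 1) : ℝ) : ℂ) := by
    intro ν
    rw [ctrl_eq, empMean_sub_const hH, empMean_inner_pow]
    push_cast
    rfl
  have hdet : (ctrlCov H y t m).det = ((momentDet (rawMoment H y t) : ℝ) : ℂ) := by
    rw [Matrix.det_fin_two]
    simp only [ctrlCov_apply hH, momentDet]
    push_cast
    simp
    ring
  rw [kappa, betaHat, hv, Matrix.inv_def, hdet, Ring.inverse_eq_inv, Matrix.adjugate_fin_two]
  simp only [hδ, ctrlCov_apply hH, correction, dotProduct, Fin.sum_univ_two, Matrix.mulVec]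
  push_cast
  simp
  ring

lemma rawMoment_smul (H : ℕ) (y : ℕ → EuclideanSpace ℝ (Fin p)) (s : ℝ)
    (u : EuclideanSpace ℝ (Fin p)) (ν : ℕ) :
    rawMoment H y (s • u) ν = s ^ ν * rawMoment H y u ν := by
  simp only [rawMoment, inner_smul_left, mul_pow, ← Finset.mul_sum]
  simp
  ring

lemma mixedMoment_smul (H : ℕ) (y : ℕ → EuclideanSpace ℝ (Fin p)) (s : ℝ)
    (t u : EuclideanSpace ℝ (Fin p)) (ν : ℕ) :
    mixedMoment H y t (s • u) ν = (s : ℂ) ^ ν * mixedMoment H y t u ν := by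
  simp only [mixedMoment, inner_smul_left, Complex.ofReal_mul, mul_pow, mul_assoc,
    ← Finset.mul_sum]
  simp
  ring

lemma momentDet_scale (s : ℝ) (M : ℕ → ℝ) :
    momentDet (fun ν => s ^ ν * M ν) = s ^ 6 * momentDet M := by
  simp only [momentDet]
  ring

/-- The correction is invariant under a rescaling of `⟨t, ·⟩`, which is what makes it bounded
near `t = 0`. -/
lemma correction_scale {s : ℝ} (hs : s ≠ 0) (M m : ℕ → ℝ) (C : ℕ → ℂ) :
    correction (fun ν => s ^ ν * M ν) (fun ν => s ^ ν * m ν) (fun ν => (s : ℂ) ^ ν * C ν)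
      = correction M m C := by
  have hs' : (s : ℂ) ≠ 0 := by exact_mod_cast hs
  simp only [correction, momentDet_scale]
  rw [Complex.ofReal_mul, mul_inv]
  have key : ∀ a b D : ℂ, a = (s : ℂ) ^ 6 * b → ((s ^ 6 : ℝ) : ℂ)⁻¹ * D * a = D * b := by
    intro a b D h
    rw [h]
    push_cast
    field_simp
  apply key
  push_cast
  ring

lemma norm_correction_le {M m : ℕ → ℝ} {C : ℕ → ℂ} {B d : ℝ} (hd : 0 < d)
    (hM : ∀ ν ∈ Finset.Icc 1 4, |M ν| ≤ B) (hD : d ≤ momentDet M)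
    (hC0 : ‖C 0‖ ≤ 1) (hC1 : ‖C 1‖ ≤ 1 + B) (hC2 : ‖C 2‖ ≤ 1 + B) :
    ‖correction M m C‖ ≤ d⁻¹ * (2 * ((B + B ^ 2) * (1 + 2 * B)))
      * (|M 1 - m 1| + |M 2 - m 2|) := by
  have h1 := hM 1 (by simp)
  have h2 := hM 2 (by simp)
  have h3 := hM 3 (by simp)
  have h4 := hM 4 (by simp)
  have hB : 0 ≤ B := (abs_nonneg _).trans h1
  have hmul : ∀ {a b : ℝ}, |a| ≤ B → |b| ≤ B → |a * b| ≤ B ^ 2 := fun ha hb => by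
    rw [abs_mul, sq]
    exact mul_le_mul ha hb (abs_nonneg _) hB
  have hS : ∀ {a b c : ℝ}, |a| ≤ B → |b| ≤ B → |c| ≤ B →
      ‖((a - b * c : ℝ) : ℂ)‖ ≤ B + B ^ 2 := fun {a b c} ha hb hc => by
    rw [Complex.norm_real, Real.norm_eq_abs]
    exact (abs_sub _ _).trans (add_le_add ha (hmul hb hc))
  have hc : ∀ {a : ℝ} {z : ℂ}, |a| ≤ B → ‖z‖ ≤ 1 + B → ‖z - a * C 0‖ ≤ 1 + 2 * B :=
    fun {a z} ha hz => by
      refine (norm_sub_le _ _).trans ?_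
      rw [norm_mul, Complex.norm_real, Real.norm_eq_abs]
      have := mul_le_mul ha hC0 (norm_nonneg _) hB
      linarith
  have hterm : ∀ {a b z z' : ℂ}, ‖a‖ ≤ B + B ^ 2 → ‖b‖ ≤ B + B ^ 2 → ‖z‖ ≤ 1 + 2 * B →
      ‖z'‖ ≤ 1 + 2 * B → ‖a * z - b * z'‖ ≤ 2 * ((B + B ^ 2) * (1 + 2 * B)) :=
    fun {a b z z'} ha hb hz hz' => by
      refine (norm_sub_le _ _).trans ?_
      rw [norm_mul, norm_mul]
      have e1 := mul_le_mul ha hz (norm_nonneg _) (by positivity)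
      have e2 := mul_le_mul hb hz' (norm_nonneg _) (by positivity)
      linarith
  have hDinv : ‖((momentDet M : ℝ) : ℂ)⁻¹‖ ≤ d⁻¹ := by
    rw [norm_inv, Complex.norm_real, Real.norm_eq_abs, abs_of_pos (hd.trans_le hD)]
    exact inv_anti₀ hd hD
  rw [correction, norm_mul, mul_assoc]
  refine mul_le_mul hDinv ?_ (norm_nonneg _) (by positivity)
  refine (norm_add_le _ _).trans ?_
  rw [norm_mul, norm_mul, Complex.norm_real, Complex.norm_real, Real.norm_eq_abs,
    Real.norm_eq_abs, mul_add]
  have e22 := hS h4 h2 h2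
  have e11 := hS h2 h1 h1
  rw [← sq] at e22 e11
  have e12 := hS h3 h1 h2
  exact add_le_add
    (mul_le_mul_of_nonneg_right (hterm e22 e12 (hc h1 hC1) (hc h2 hC2)) (abs_nonneg _))
    (mul_le_mul_of_nonneg_right (hterm e11 e12 (hc h2 hC2) (hc h1 hC1)) (abs_nonneg _))

lemma norm_mixedMoment_zero_le (H : ℕ) (y : ℕ → EuclideanSpace ℝ (Fin p))
    (t u : EuclideanSpace ℝ (Fin p)) : ‖mixedMoment H y t u 0‖ ≤ 1 := by
  have h : ‖∑ j ∈ Finset.range H, ((inner ℝ u (y j) : ℝ) : ℂ) ^ 0 * expChar t (y j)‖ ≤ H := by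
    refine (norm_sum_le _ _).trans ?_
    simp [norm_expChar]
  rw [mixedMoment, norm_mul, norm_div, norm_one, Complex.norm_natCast, one_div]
  exact inv_mul_le_one_of_le₀ h (Nat.cast_nonneg H)

lemma norm_mixedMoment_one_le (H : ℕ) (y : ℕ → EuclideanSpace ℝ (Fin p))
    (t u : EuclideanSpace ℝ (Fin p)) : ‖mixedMoment H y t u 1‖ ≤ 1 + rawMoment H y u 2 := by
  rcases Nat.eq_zero_or_pos H with rfl | hH
  · simp [mixedMoment, rawMoment]
  have hH' : (0 : ℝ) < H := by exact_mod_cast hH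
  have h : ‖∑ j ∈ Finset.range H, ((inner ℝ u (y j) : ℝ) : ℂ) ^ 1 * expChar t (y j)‖
      ≤ ∑ j ∈ Finset.range H, (1 + (inner ℝ u (y j) : ℝ) ^ 2) := by
    refine (norm_sum_le _ _).trans (Finset.sum_le_sum fun j _ => ?_)
    rw [norm_mul, norm_expChar, pow_one, mul_one, Complex.norm_real, Real.norm_eq_abs]
    nlinarith [sq_abs (inner ℝ u (y j) : ℝ), sq_nonneg (|(inner ℝ u (y j) : ℝ)| - 1)]
  rw [mixedMoment, rawMoment, norm_mul, norm_div, norm_one, Complex.norm_natCast, one_div,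
    inv_mul_le_iff₀ hH', mul_add, mul_inv_cancel_left₀ hH'.ne']
  simpa [Finset.sum_add_distrib] using h

lemma norm_mixedMoment_two_le (H : ℕ) (y : ℕ → EuclideanSpace ℝ (Fin p))
    (t u : EuclideanSpace ℝ (Fin p)) : ‖mixedMoment H y t u 2‖ ≤ rawMoment H y u 2 := by
  have h : ‖∑ j ∈ Finset.range H, ((inner ℝ u (y j) : ℝ) : ℂ) ^ 2 * expChar t (y j)‖
      ≤ ∑ j ∈ Finset.range H, (inner ℝ u (y j) : ℝ) ^ 2 := by
    refine (norm_sum_le _ _).trans (Finset.sum_le_sum fun j _ => ?_)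
    rw [norm_mul, norm_expChar, mul_one, norm_pow, Complex.norm_real, Real.norm_eq_abs, sq_abs]
  rw [mixedMoment, rawMoment, norm_mul, norm_div, norm_one, Complex.norm_natCast]
  exact mul_le_mul_of_nonneg_left h (by positivity)

lemma norm_kappa_le {H : ℕ} (hH : H ≠ 0) {y : ℕ → EuclideanSpace ℝ (Fin p)} {s : ℝ} (hs : s ≠ 0)
    {u : EuclideanSpace ℝ (Fin p)} {m : ℕ → ℝ} {B d : ℝ} (hd : 0 < d)
    (hM : ∀ ν ∈ Finset.Icc 1 4, |rawMoment H y u ν| ≤ B) (hD : d ≤ momentDet (rawMoment H y u)) :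
    ‖kappa H y (s • u) (fun ν => s ^ ν * m ν)‖ ≤ d⁻¹ * (2 * ((B + B ^ 2) * (1 + 2 * B)))
      * (|rawMoment H y u 1 - m 1| + |rawMoment H y u 2 - m 2|) := by
  have h2 := (le_abs_self _).trans (hM 2 (by simp))
  rw [kappa_eq_correction hH]
  have e1 : rawMoment H y (s • u) = fun ν => s ^ ν * rawMoment H y u ν :=
    funext (rawMoment_smul H y s u)
  have e2 : mixedMoment H y (s • u) (s • u)
      = fun ν => (s : ℂ) ^ ν * mixedMoment H y (s • u) u ν :=
    funext (mixedMoment_smul H y s (s • u) u)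
  rw [e1, e2, correction_scale hs]
  exact norm_correction_le hd hM hD (norm_mixedMoment_zero_le _ _ _ _)
    ((norm_mixedMoment_one_le _ _ _ _).trans (by linarith))
    ((norm_mixedMoment_two_le _ _ _ _).trans (by linarith))

/-! ### Dependence of the correction on the parameter and on the argument -/

lemma continuous_correction {S : Type*} [TopologicalSpace S] {M m : ℕ → S → ℝ} {C : ℕ → S → ℂ}
    (hM : ∀ ν, Continuous (M ν)) (hm₁ : Continuous (m 1)) (hm₂ : Continuous (m 2))
    (hC : ∀ ν, Continuous (C ν))
    (hD : ∀ z, momentDet (fun ν => M ν z) ≠ 0) :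
    Continuous fun z => correction (fun ν => M ν z) (fun ν => m ν z) (fun ν => C ν z) := by
  have hDc : Continuous fun z => ((momentDet (fun ν => M ν z) : ℝ) : ℂ)⁻¹ := by
    refine Continuous.inv₀ ?_ fun z => by exact_mod_cast hD z
    simp only [momentDet]
    fun_prop
  simp only [correction]
  fun_prop

lemma measurable_correction {S : Type*} [MeasurableSpace S] {M m : ℕ → S → ℝ} {C : ℕ → S → ℂ}
    (hM : ∀ ν, Measurable (M ν)) (hm : ∀ ν, Measurable (m ν)) (hC : ∀ ν, Measurable (C ν)) :
    Measurable fun z => correction (fun ν => M ν z) (fun ν => m ν z) (fun ν => C ν z) := by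
  simp only [correction, momentDet]
  fun_prop

lemma continuous_rawMoment {S : Type*} [TopologicalSpace S] (H : ℕ)
    {y : S → ℕ → EuclideanSpace ℝ (Fin p)} {t : S → EuclideanSpace ℝ (Fin p)}
    (hy : ∀ j, Continuous fun z => y z j) (ht : Continuous t) (ν : ℕ) :
    Continuous fun z => rawMoment H (y z) (t z) ν := by
  simp only [rawMoment]
  fun_prop

lemma continuous_mixedMoment {S : Type*} [TopologicalSpace S] (H : ℕ)
    {y : S → ℕ → EuclideanSpace ℝ (Fin p)} {t : S → EuclideanSpace ℝ (Fin p)}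
    (hy : ∀ j, Continuous fun z => y z j) (ht : Continuous t) (ν : ℕ) :
    Continuous fun z => mixedMoment H (y z) (t z) (t z) ν := by
  simp only [mixedMoment, expChar]
  fun_prop

lemma continuous_mcChf {S : Type*} [TopologicalSpace S] (H : ℕ)
    {y : S → ℕ → EuclideanSpace ℝ (Fin p)} {t : S → EuclideanSpace ℝ (Fin p)}
    (hy : ∀ j, Continuous fun z => y z j) (ht : Continuous t) :
    Continuous fun z => mcChf H (y z) (t z) := by
  simp only [mcChf, empMean, expChar]
  fun_prop

lemma norm_mcChf_le (H : ℕ) (y : ℕ → EuclideanSpace ℝ (Fin p)) (t : EuclideanSpace ℝ (Fin p)) :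
    ‖mcChf H y t‖ ≤ 1 := by
  have h := norm_mixedMoment_zero_le H y t t
  simpa [mixedMoment, mcChf, empMean] using h

lemma norm_ecf_le (n : ℕ) (x : ℤ → ℝ) (t : EuclideanSpace ℝ (Fin p)) : ‖ecf p n x t‖ ≤ 1 :=
  norm_mcChf_le n (fun j => block p x ((j : ℤ) + 1)) t

lemma measurable_ecf (n : ℕ) (x : ℤ → ℝ) :
    Measurable fun t : EuclideanSpace ℝ (Fin p) => ecf p n x t :=
  (continuous_mcChf (S := EuclideanSpace ℝ (Fin p)) n
    (y := fun _ j => block p x ((j : ℤ) + 1)) (fun _ => continuous_const) continuous_id).measurable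

lemma measurable_estVar (n : ℕ) (x : ℤ → ℝ) :
    Measurable fun t : EuclideanSpace ℝ (Fin p) => estVar p n x t := by
  simp only [estVar_eq_sum]
  fun_prop

lemma measurable_kappa {H : ℕ} (hH : H ≠ 0) (y : ℕ → EuclideanSpace ℝ (Fin p))
    {m : EuclideanSpace ℝ (Fin p) → ℕ → ℝ} (hm : ∀ ν, Measurable fun t => m t ν) :
    Measurable fun t => kappa H y t (m t) := by
  simp only [kappa_eq_correction hH]
  exact measurable_correction
    (fun ν => (continuous_rawMoment (y := fun _ => y) H (fun _ => continuous_const)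
      continuous_id ν).measurable) hm
    (fun ν => (continuous_mixedMoment (y := fun _ => y) H (fun _ => continuous_const)
      continuous_id ν).measurable)

end Correction

/-! ### Moments of the model blocks -/

section Moments

variable {p : ℕ}

lemma norm_pow_four_le (v : EuclideanSpace ℝ (Fin p)) : ‖v‖ ^ 4 ≤ p * ∑ i, ‖v i‖ ^ 4 := by
  have h1 : ‖v‖ ^ 4 = (∑ i, ‖v i‖ ^ 2) ^ 2 := by rw [← EuclideanSpace.norm_sq_eq]; ring
  have h2 := sq_sum_le_card_mul_sum_sq (s := (Finset.univ : Finset (Fin p)))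
    (f := fun i => ‖v i‖ ^ 2)
  rw [h1]
  refine h2.trans (le_of_eq ?_)
  simp only [Finset.card_univ, Fintype.card_fin, ← pow_mul]

lemma enorm_pow_four_le (v : EuclideanSpace ℝ (Fin p)) :
    ‖v‖ₑ ^ 4 ≤ p * ∑ i, ‖v i‖ₑ ^ 4 := by
  have h := ENNReal.ofReal_le_ofReal (norm_pow_four_le v)
  rw [ENNReal.ofReal_mul (by positivity), ENNReal.ofReal_sum_of_nonneg (fun _ _ => by positivity),
    ENNReal.ofReal_pow (norm_nonneg _), ofReal_norm, ENNReal.ofReal_natCast] at h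
  simpa only [ENNReal.ofReal_pow (norm_nonneg _), ofReal_norm] using h

variable {Ω' Θ : Type*} [MeasurableSpace Ω'] {P' : Measure Ω'} {Y : ℤ → Θ → Ω' → ℝ}

lemma lintegral_iSup_coord_eq
    (hYstat : IdentDistrib (fun ω (i : ℤ) (θ : Θ) => Y (i + 1) θ ω)
      (fun ω (i : ℤ) (θ : Θ) => Y i θ ω) P' P') (D : ℕ → Θ) (k : ℕ) :
    ∫⁻ ω, ⨆ n, ‖Y (1 + k) (D n) ω‖ₑ ^ 4 ∂P' = ∫⁻ ω, ⨆ n, ‖Y 1 (D n) ω‖ₑ ^ 4 ∂P' := by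
  induction k with
  | zero => simp
  | succ k ih =>
    rw [← ih]
    have hg : Measurable fun (x : ℤ → Θ → ℝ) => ⨆ n, ‖x (1 + k) (D n)‖ₑ ^ 4 :=
      Measurable.iSup fun n => ((measurable_pi_apply (D n)).comp
        (measurable_pi_apply (1 + k : ℤ))).enorm.pow_const 4
    have h := (hYstat.comp hg).lintegral_eq
    simp only [Function.comp_def] at h
    rw [← h]
    push_cast
    simp only [add_assoc]

/-- The supremum of the block norms over countably many parameters has a finite fourth moment.
Countably many parameters are taken because the supremum over all of them need not be measurable. -/
lemma lintegral_iSup_modelBlock_lt_top (hYmeas : ∀ j θ, Measurable (Y j θ))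
    (hYstat : IdentDistrib (fun ω (i : ℤ) (θ : Θ) => Y (i + 1) θ ω)
      (fun ω (i : ℤ) (θ : Θ) => Y i θ ω) P' P')
    (hYmom : ∫⁻ ω, (⨆ θ : Θ, ‖Y 1 θ ω‖ₑ ^ 4) ∂P' < ⊤) (D : ℕ → Θ) :
    ∫⁻ ω, ⨆ n, ‖modelBlock p Y (D n) ω‖ₑ ^ 4 ∂P' < ⊤ := by
  have h1 : ∀ ω, ⨆ n, ‖modelBlock p Y (D n) ω‖ₑ ^ 4
      ≤ p * ∑ i : Fin p, ⨆ n, ‖Y (1 + (i : ℕ)) (D n) ω‖ₑ ^ 4 := by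
    intro ω
    refine iSup_le fun n => (enorm_pow_four_le _).trans ?_
    gcongr with i
    exact le_iSup (fun n => ‖Y (1 + (i : ℕ)) (D n) ω‖ₑ ^ 4) n
  have hm : ∀ i : ℕ, Measurable fun ω => ⨆ n, ‖Y (1 + i) (D n) ω‖ₑ ^ 4 := fun i =>
    Measurable.iSup fun n => (hYmeas _ _).enorm.pow_const 4
  refine (lintegral_mono h1).trans_lt ?_
  rw [lintegral_const_mul' _ _ (ENNReal.natCast_ne_top p),
    lintegral_finsetSum (f := fun (i : Fin p) ω => ⨆ n, ‖Y (1 + (i : ℕ)) (D n) ω‖ₑ ^ 4) _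
      fun i _ => hm i]
  simp only [lintegral_iSup_coord_eq hYstat]
  refine ENNReal.mul_lt_top (by simp) (ENNReal.sum_lt_top.2 fun i _ => lt_of_le_of_lt ?_ hYmom)
  exact lintegral_mono fun ω => iSup_le fun n => le_iSup (fun θ => ‖Y 1 θ ω‖ₑ ^ 4) (D n)

end Moments

/-! ### Nondegeneracy of the control variates -/

section Nondegenerate

variable {Ω : Type*} [MeasurableSpace Ω] {P : Measure Ω}

lemma integral_quartic {U : Ω → ℝ} [IsProbabilityMeasure P]
    (hU : ∀ ν ≤ 4, Integrable (fun ω => U ω ^ ν) P) (c₀ c₁ c₂ c₃ c₄ : ℝ) :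
    ∫ ω, (c₀ + c₁ * U ω + c₂ * U ω ^ 2 + c₃ * U ω ^ 3 + c₄ * U ω ^ 4) ∂P
      = c₀ + c₁ * ∫ ω, U ω ^ 1 ∂P + c₂ * ∫ ω, U ω ^ 2 ∂P + c₃ * ∫ ω, U ω ^ 3 ∂P
        + c₄ * ∫ ω, U ω ^ 4 ∂P := by
  have i1 : Integrable (fun ω => c₁ * U ω) P := by simpa using (hU 1 (by norm_num)).const_mul c₁
  have i2 := (hU 2 (by norm_num)).const_mul c₂
  have i3 := (hU 3 (by norm_num)).const_mul c₃
  have i4 := (hU 4 le_rfl).const_mul c₄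
  have j1 : Integrable (fun ω => c₀ + c₁ * U ω) P := (integrable_const _).add i1
  have j2 : Integrable (fun ω => c₀ + c₁ * U ω + c₂ * U ω ^ 2) P := j1.add i2
  have j3 : Integrable (fun ω => c₀ + c₁ * U ω + c₂ * U ω ^ 2 + c₃ * U ω ^ 3) P := j2.add i3
  rw [integral_add j3 i4, integral_add j2 i3, integral_add j1 i2,
    integral_add (integrable_const _) i1]
  simp only [integral_const_mul, integral_const, probReal_univ, one_smul, pow_one]

/-- The covariance matrix of `U` and `U ^ 2` is nonsingular when `U` satisfies no quadratic
equation: with `v = Var U` and `a = Cov (U, U ^ 2)`, the variance of `v U ^ 2 - a U` is `v` times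
the determinant. -/
lemma momentDet_pos [IsProbabilityMeasure P] {U : Ω → ℝ}
    (hU : ∀ ν ≤ 4, Integrable (fun ω => U ω ^ ν) P)
    (hnd : ∀ a b c : ℝ, (∀ᵐ ω ∂P, a * U ω + b * U ω ^ 2 + c = 0) → a = 0 ∧ b = 0 ∧ c = 0) :
    0 < momentDet fun ν => ∫ ω, U ω ^ ν ∂P := by
  set m : ℕ → ℝ := fun ν => ∫ ω, U ω ^ ν ∂P with hm
  have hpos : ∀ a b c : ℝ, (a ≠ 0 ∨ b ≠ 0) → 0 < c ^ 2 + 2 * a * c * m 1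
      + (a ^ 2 + 2 * b * c) * m 2 + 2 * a * b * m 3 + b ^ 2 * m 4 := by
    intro a b c hab
    have hexp : ∀ ω, (a * U ω + b * U ω ^ 2 + c) ^ 2 = c ^ 2 + 2 * a * c * U ω
        + (a ^ 2 + 2 * b * c) * U ω ^ 2 + 2 * a * b * U ω ^ 3 + b ^ 2 * U ω ^ 4 := by
      intro ω; ring
    rw [← integral_quartic hU]
    simp only [← hexp]
    refine (integral_nonneg fun ω => sq_nonneg _).lt_of_ne' fun h0 => ?_
    have hi : Integrable (fun ω => (a * U ω + b * U ω ^ 2 + c) ^ 2) P := by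
      simp only [hexp]
      have i1 : Integrable U P := by simpa using hU 1 (by norm_num)
      exact ((((integrable_const _).add (i1.const_mul _)).add
        ((hU 2 (by norm_num)).const_mul _)).add ((hU 3 (by norm_num)).const_mul _)).add
        ((hU 4 le_rfl).const_mul _)
    have h1 := (integral_eq_zero_iff_of_nonneg (fun ω => sq_nonneg _) hi).1 h0
    have h2 := hnd a b c (by
      filter_upwards [h1] with ω hω
      simpa using hω)
    rcases hab with h | h
    · exact h h2.1
    · exact h h2.2.1
  have hv : 0 < m 2 - m 1 ^ 2 := by
    have := hpos 1 0 (-m 1) (Or.inl one_ne_zero)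
    nlinarith
  have hW := hpos (-(m 3 - m 1 * m 2)) (m 2 - m 1 ^ 2)
    ((m 3 - m 1 * m 2) * m 1 - (m 2 - m 1 ^ 2) * m 2) (Or.inr hv.ne')
  refine pos_of_mul_pos_right ?_ hv.le
  refine lt_of_lt_of_eq hW ?_
  simp only [momentDet]
  ring

end Nondegenerate

/-! ### Uniform convergence of the simulated averages -/

section Simulation

variable {Ω T : Type*} [MeasurableSpace Ω] {P : Measure Ω} {p : ℕ}
  {Z : ℕ → T → Ω → EuclideanSpace ℝ (Fin p)}

lemma abs_pow_le_one_add_pow_four (x : ℝ) {ν : ℕ} (hν : ν ≤ 4) : |x| ^ ν ≤ 1 + |x| ^ 4 := by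
  rcases le_total |x| 1 with h | h
  · exact (pow_le_one₀ (abs_nonneg _) h).trans (by simp)
  · exact (pow_le_pow_right₀ h hν).trans (by simp)

lemma abs_inner_pow_le {u x : EuclideanSpace ℝ (Fin p)} {ν : ℕ} (hν : ν ≤ 4) :
    |(inner ℝ u x : ℝ) ^ ν| ≤ (1 + ‖u‖ ^ 4) * (1 + ‖x‖ ^ 4) := by
  rw [abs_pow]
  refine (abs_pow_le_one_add_pow_four _ hν).trans ?_
  have h := pow_le_pow_left₀ (abs_nonneg _) (abs_real_inner_le_norm u x) 4
  rw [mul_pow] at h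
  nlinarith [pow_nonneg (norm_nonneg u) 4, pow_nonneg (norm_nonneg x) 4]

lemma integrable_inner_pow [IsProbabilityMeasure P] (hmeas : ∀ j θ, Measurable (Z j θ))
    (hmom : ∫⁻ ω, ⨆ θ, ‖Z 0 θ ω‖ₑ ^ 4 ∂P < ⊤) (θ : T) (u : EuclideanSpace ℝ (Fin p))
    {ν : ℕ} (hν : ν ≤ 4) : Integrable (fun ω => (inner ℝ u (Z 0 θ ω) : ℝ) ^ ν) P := by
  have h4 : Integrable (fun ω => ‖Z 0 θ ω‖ ^ 4) P := by
    refine ⟨((hmeas 0 θ).norm.pow_const 4).aestronglyMeasurable, lt_of_le_of_lt ?_ hmom⟩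
    refine lintegral_mono fun ω => ?_
    rw [enorm_pow, enorm_norm]
    exact le_iSup (fun θ => ‖Z 0 θ ω‖ₑ ^ 4) θ
  have hm := hmeas 0 θ
  refine Integrable.mono' (((integrable_const (1 : ℝ)).add h4).const_mul (1 + ‖u‖ ^ 4))
    (by fun_prop) (ae_of_all _ fun ω => ?_)
  exact abs_inner_pow_le hν

variable [TopologicalSpace T] [CompactSpace T] [SecondCountableTopology T] [T2Space T] [Nonempty T]

/-- Averages of `G (s, ·)` over the simulated blocks converge almost surely, uniformly in the
index `s` and the parameter, for a continuous family `G` of at most quartic growth. -/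
lemma ae_tendstoUniformly_simulated {S F : Type*} [TopologicalSpace S] [CompactSpace S]
    [SecondCountableTopology S] [T2Space S] [Nonempty S]
    [NormedAddCommGroup F] [SecondCountableTopology F] [MeasurableSpace F] [BorelSpace F]
    [NormedSpace ℝ F] [CompleteSpace F] [IsProbabilityMeasure P]
    (hmeas : ∀ j θ, Measurable (Z j θ)) (hcont : ∀ j ω, Continuous fun θ => Z j θ ω)
    (hident : ∀ j, IdentDistrib (fun ω θ => Z j θ ω) (fun ω θ => Z 0 θ ω) P P)
    (hindep : iIndepFun (fun (j : ℕ) ω (θ : T) => Z j θ ω) P)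
    (hmom : ∫⁻ ω, ⨆ θ, ‖Z 0 θ ω‖ₑ ^ 4 ∂P < ⊤)
    (G : S → EuclideanSpace ℝ (Fin p) → F)
    (hG : Continuous fun z : S × EuclideanSpace ℝ (Fin p) => G z.1 z.2)
    {C : ℝ} (hC : 0 ≤ C) (hbound : ∀ s x, ‖G s x‖ ≤ C * (1 + ‖x‖ ^ 4)) :
    ∀ᵐ ω ∂P, TendstoUniformly
      (fun (n : ℕ) (z : S × T) => (n : ℝ)⁻¹ • ∑ j ∈ Finset.range n, G z.1 (Z j z.2 ω))
      (fun z => ∫ ω, G z.1 (Z 0 z.2 ω) ∂P) atTop := by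
  let A : ℕ → Ω → C(S × T, F) := fun j ω =>
    ⟨fun z => G z.1 (Z j z.2 ω), hG.comp (continuous_fst.prodMk ((hcont j ω).comp continuous_snd))⟩
  have hGs : ∀ s, Measurable (G s) := fun s =>
    (hG.comp (continuous_const.prodMk continuous_id)).measurable
  have hΦ : Measurable fun (x : T → EuclideanSpace ℝ (Fin p)) (z : S × T) => G z.1 (x z.2) :=
    measurable_pi_lambda _ fun z => (hGs z.1).comp (measurable_pi_apply z.2)
  refine ae_tendstoUniformly_average A (fun j z => (hGs z.1).comp (hmeas j z.2))
    (fun j => (hident j).comp hΦ) (fun i j hij => (hindep.indepFun hij).comp hΦ hΦ) ?_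
  have hle : ∀ ω, ‖A 0 ω‖ₑ ≤ ENNReal.ofReal C * (1 + ⨆ θ, ‖Z 0 θ ω‖ₑ ^ 4) := by
    intro ω
    obtain ⟨z, -, hz⟩ := isCompact_univ.exists_isMaxOn Set.univ_nonempty
      (A 0 ω).continuous.norm.continuousOn
    have h1 : ‖A 0 ω‖ ≤ ‖A 0 ω z‖ :=
      (ContinuousMap.norm_le _ (norm_nonneg _)).2 fun x => hz (Set.mem_univ x)
    have h2 := ENNReal.ofReal_le_ofReal (h1.trans (hbound z.1 (Z 0 z.2 ω)))
    rw [ofReal_norm, ENNReal.ofReal_mul hC,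
      ENNReal.ofReal_add zero_le_one (by positivity), ENNReal.ofReal_one,
      ENNReal.ofReal_pow (norm_nonneg _), ofReal_norm] at h2
    refine h2.trans ?_
    gcongr
    exact le_iSup (fun θ => ‖Z 0 θ ω‖ₑ ^ 4) z.2
  refine (lintegral_mono hle).trans_lt ?_
  rw [lintegral_const_mul' _ _ ENNReal.ofReal_ne_top, lintegral_add_left measurable_const]
  refine ENNReal.mul_lt_top ENNReal.ofReal_lt_top (ENNReal.add_lt_top.2 ⟨?_, hmom⟩)
  simp

lemma ae_tendstoUniformly_rawMoment [IsProbabilityMeasure P]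
    [Nonempty (Metric.sphere (0 : EuclideanSpace ℝ (Fin p)) 1)]
    (hmeas : ∀ j θ, Measurable (Z j θ)) (hcont : ∀ j ω, Continuous fun θ => Z j θ ω)
    (hident : ∀ j, IdentDistrib (fun ω θ => Z j θ ω) (fun ω θ => Z 0 θ ω) P P)
    (hindep : iIndepFun (fun (j : ℕ) ω (θ : T) => Z j θ ω) P)
    (hmom : ∫⁻ ω, ⨆ θ, ‖Z 0 θ ω‖ₑ ^ 4 ∂P < ⊤) :
    ∀ᵐ ω ∂P, ∀ ν ≤ 4, TendstoUniformly
      (fun (n : ℕ) (z : Metric.sphere (0 : EuclideanSpace ℝ (Fin p)) 1 × T) =>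
        rawMoment n (fun j => Z j z.2 ω) z.1 ν)
      (fun z => ∫ ω, (inner ℝ (z.1 : EuclideanSpace ℝ (Fin p)) (Z 0 z.2 ω) : ℝ) ^ ν ∂P) atTop := by
  rw [ae_all_iff]
  intro ν
  by_cases hν : ν ≤ 4
  · have h := ae_tendstoUniformly_simulated hmeas hcont hident hindep hmom
      (S := Metric.sphere (0 : EuclideanSpace ℝ (Fin p)) 1)
      (fun s x => (inner ℝ (s : EuclideanSpace ℝ (Fin p)) x : ℝ) ^ ν) (by fun_prop) zero_le_two
      (fun s x => by
        refine (abs_inner_pow_le (u := (s : EuclideanSpace ℝ (Fin p))) hν).trans_eq ?_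
        rw [norm_eq_of_mem_sphere s]
        norm_num)
    filter_upwards [h] with ω hω _
    simpa only [rawMoment, one_div, smul_eq_mul] using hω
  · exact ae_of_all _ fun ω h => absurd h hν

lemma ae_tendstoUniformly_mcChf [IsProbabilityMeasure P]
    (hmeas : ∀ j θ, Measurable (Z j θ)) (hcont : ∀ j ω, Continuous fun θ => Z j θ ω)
    (hident : ∀ j, IdentDistrib (fun ω θ => Z j θ ω) (fun ω θ => Z 0 θ ω) P P)
    (hindep : iIndepFun (fun (j : ℕ) ω (θ : T) => Z j θ ω) P)
    (hmom : ∫⁻ ω, ⨆ θ, ‖Z 0 θ ω‖ₑ ^ 4 ∂P < ⊤) :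
    ∀ᵐ ω ∂P, ∀ t : EuclideanSpace ℝ (Fin p), TendstoUniformly
      (fun (n : ℕ) (θ : T) => mcChf n (fun j => Z j θ ω) t)
      (fun θ => ∫ ω, expChar t (Z 0 θ ω) ∂P) atTop := by
  have key : ∀ R : ℕ, ∀ᵐ ω ∂P, TendstoUniformly
      (fun (n : ℕ) (z : Metric.closedBall (0 : EuclideanSpace ℝ (Fin p)) R × T) =>
        (n : ℝ)⁻¹ • ∑ j ∈ Finset.range n,
          expChar (z.1 : EuclideanSpace ℝ (Fin p)) (Z j z.2 ω))
      (fun z => ∫ ω, expChar (z.1 : EuclideanSpace ℝ (Fin p)) (Z 0 z.2 ω) ∂P) atTop := by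
    intro R
    have : Nonempty (Metric.closedBall (0 : EuclideanSpace ℝ (Fin p)) R) :=
      ⟨⟨0, Metric.mem_closedBall_self (Nat.cast_nonneg R)⟩⟩
    have : CompactSpace (Metric.closedBall (0 : EuclideanSpace ℝ (Fin p)) R) :=
      isCompact_iff_compactSpace.1 (isCompact_closedBall _ _)
    exact ae_tendstoUniformly_simulated hmeas hcont hident hindep hmom
      (S := Metric.closedBall (0 : EuclideanSpace ℝ (Fin p)) R)
      (fun s x => expChar (s : EuclideanSpace ℝ (Fin p)) x)
      (by unfold expChar; fun_prop) zero_le_one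
      (fun s x => by
        rw [norm_expChar, one_mul]
        exact le_add_of_nonneg_right (by positivity))
  filter_upwards [ae_all_iff.2 key] with ω hω t
  obtain ⟨R, hR⟩ := exists_nat_ge ‖t‖
  have h := (hω R).comp fun θ : T =>
    ((⟨t, by simpa using hR⟩ : Metric.closedBall (0 : EuclideanSpace ℝ (Fin p)) R), θ)
  refine (tendstoUniformly_congr (Eventually.of_forall fun n => ?_)).1 h
  funext θ
  simp [mcChf, empMean]

end Simulation

/-! ### The correction vanishes uniformly -/

section Vanishing

variable {T : Type*} [TopologicalSpace T] {p : ℕ}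
  {y : T → ℕ → EuclideanSpace ℝ (Fin p)} {m : T → EuclideanSpace ℝ (Fin p) → ℕ → ℝ}

lemma exists_norm_smul_sphere {t : EuclideanSpace ℝ (Fin p)} (ht : t ≠ 0) :
    ∃ u : Metric.sphere (0 : EuclideanSpace ℝ (Fin p)) 1,
      t = ‖t‖ • (u : EuclideanSpace ℝ (Fin p)) := by
  have hn : ‖t‖ ≠ 0 := norm_ne_zero_iff.2 ht
  exact ⟨⟨‖t‖⁻¹ • t, by simp [norm_smul, hn]⟩, by simp [smul_smul, hn]⟩

lemma continuous_of_tendstoUniformly_rawMoment (hy : ∀ j, Continuous fun θ => y θ j) {ν : ℕ}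
    (h : TendstoUniformly
      (fun (n : ℕ) (z : Metric.sphere (0 : EuclideanSpace ℝ (Fin p)) 1 × T) =>
        rawMoment n (y z.2) z.1 ν) (fun z => m z.2 z.1 ν) atTop) :
    Continuous fun z : Metric.sphere (0 : EuclideanSpace ℝ (Fin p)) 1 × T => m z.2 z.1 ν :=
  h.continuous (Frequently.of_forall fun n => continuous_rawMoment n
    (fun j => (hy j).comp continuous_snd) (continuous_subtype_val.comp continuous_fst) ν)

/-- On unit vectors, the empirical moments are eventually bounded and the determinant of the
empirical covariance matrix is eventually bounded away from zero, uniformly in the parameter. -/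
lemma eventually_rawMoment_bounds [CompactSpace T] (hy : ∀ j, Continuous fun θ => y θ j)
    (hconv : ∀ ν ≤ 4, TendstoUniformly
      (fun (n : ℕ) (z : Metric.sphere (0 : EuclideanSpace ℝ (Fin p)) 1 × T) =>
        rawMoment n (y z.2) z.1 ν) (fun z => m z.2 z.1 ν) atTop)
    (hdet : ∀ θ t, t ≠ 0 → 0 < momentDet (m θ t)) :
    ∃ B d : ℝ, 0 ≤ B ∧ 0 < d ∧ ∀ᶠ n in atTop,
      ∀ z : Metric.sphere (0 : EuclideanSpace ℝ (Fin p)) 1 × T,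
        (∀ ν ∈ Finset.Icc 1 4, |rawMoment n (y z.2) z.1 ν| ≤ B)
          ∧ d ≤ momentDet (rawMoment n (y z.2) z.1) := by
  set K := Metric.sphere (0 : EuclideanSpace ℝ (Fin p)) 1 × T with hK
  let Mc : ℕ → ℕ → C(K, ℝ) := fun n ν => ⟨fun z => rawMoment n (y z.2) z.1 ν,
    continuous_rawMoment n (fun j => (hy j).comp continuous_snd)
      (continuous_subtype_val.comp continuous_fst) ν⟩
  have hmc : ∀ ν ≤ 4, Continuous fun z : K => m z.2 z.1 ν := fun ν hν =>
    continuous_of_tendstoUniformly_rawMoment hy (hconv ν hν)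
  -- the limits as elements of `C(K, ℝ)`; only the orders up to four are known to be continuous
  obtain ⟨mc, hmc_apply, hlim⟩ : ∃ mc : ℕ → C(K, ℝ), (∀ ν ≤ 4, ∀ z : K, mc ν z = m z.2 z.1 ν)
      ∧ ∀ ν ≤ 4, Tendsto (fun n => Mc n ν) atTop (𝓝 (mc ν)) := by
    refine ⟨fun ν => if hν : ν ≤ 4 then ⟨fun z => m z.2 z.1 ν, hmc ν hν⟩ else 0,
      fun ν hν z => by simp [hν], fun ν hν => ?_⟩
    rw [ContinuousMap.tendsto_iff_tendstoUniformly]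
    simp only [hν]
    exact hconv ν hν
  let det : (ℕ → C(K, ℝ)) → C(K, ℝ) := fun M =>
    (M 2 - M 1 ^ 2) * (M 4 - M 2 ^ 2) - (M 3 - M 1 * M 2) ^ 2
  -- polynomials act continuously on the normed algebra `C(K, ℝ)`
  have hdetlim : Tendsto (fun n => det (Mc n)) atTop (𝓝 (det mc)) := by
    have h1 := hlim 1 (by norm_num)
    have h2 := hlim 2 (by norm_num)
    have h3 := hlim 3 (by norm_num)
    have h4 := hlim 4 le_rfl
    exact ((h2.sub (h1.pow 2)).mul (h4.sub (h2.pow 2))).sub ((h3.sub (h1.mul h2)).pow 2)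
  have hdet_apply : ∀ z, det mc z = momentDet (m z.2 z.1) := fun z => by
    have h : det mc z = (mc 2 z - mc 1 z ^ 2) * (mc 4 z - mc 2 z ^ 2)
      - (mc 3 z - mc 1 z * mc 2 z) ^ 2 := rfl
    rw [h, hmc_apply 1 (by norm_num), hmc_apply 2 (by norm_num), hmc_apply 3 (by norm_num),
      hmc_apply 4 le_rfl, momentDet]
  obtain ⟨d, hd0, hd⟩ := isCompact_univ.exists_forall_le' (f := det mc) (a := 0)
    (det mc).continuous.continuousOn fun z _ => by
      rw [hdet_apply]
      exact hdet _ _ (ne_zero_of_mem_unit_sphere z.1)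
  refine ⟨∑ ν ∈ Finset.Icc 1 4, (‖mc ν‖ + 1), d / 2, by positivity, by positivity, ?_⟩
  have hev : ∀ᶠ n in atTop, ∀ ν ∈ Finset.Icc 1 4, ‖Mc n ν‖ < ‖mc ν‖ + 1 := by
    rw [Filter.eventually_all_finset]
    intro ν hν
    exact ((hlim ν (Finset.mem_Icc.1 hν).2).norm).eventually_lt_const (by linarith)
  have hevd := (Metric.tendsto_nhds.1 hdetlim) (d / 2) (by positivity)
  filter_upwards [hev, hevd] with n hn hnd z
  constructor
  · intro ν hν
    refine ((Mc n ν).norm_coe_le_norm z).trans ((hn ν hν).le.trans ?_)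
    exact Finset.single_le_sum (f := fun ν => ‖mc ν‖ + 1) (fun i _ => by positivity) hν
  · have h1 := (ContinuousMap.dist_apply_le_dist z).trans hnd.le
    rw [Real.dist_eq] at h1
    have h2 := hd z (Set.mem_univ z)
    have h3 : det (Mc n) z = momentDet (rawMoment n (y z.2) z.1) := rfl
    rw [← h3]
    linarith [(abs_le.1 h1).1]

/-- The correction tends to zero uniformly in the parameter and in `t ≠ 0`, by reduction to unit
vectors. -/
lemma eventually_norm_kappa_le [CompactSpace T] (hy : ∀ j, Continuous fun θ => y θ j)
    (hconv : ∀ ν ≤ 4, TendstoUniformly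
      (fun (n : ℕ) (z : Metric.sphere (0 : EuclideanSpace ℝ (Fin p)) 1 × T) =>
        rawMoment n (y z.2) z.1 ν) (fun z => m z.2 z.1 ν) atTop)
    (hdet : ∀ θ t, t ≠ 0 → 0 < momentDet (m θ t))
    (hscale : ∀ θ t (s : ℝ) ν, m θ (s • t) ν = s ^ ν * m θ t ν) {ε : ℝ} (hε : 0 < ε) :
    ∀ᶠ n in atTop, ∀ θ t, t ≠ 0 → ‖kappa n (y θ) t (m θ t)‖ ≤ ε := by
  obtain ⟨B, d, hB, hd, hev⟩ := eventually_rawMoment_bounds hy hconv hdet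
  set K := d⁻¹ * (2 * ((B + B ^ 2) * (1 + 2 * B))) with hK
  have hK0 : 0 ≤ K := by positivity
  have hδ : 0 < ε / (2 * (K + 1)) := by positivity
  filter_upwards [hev, Metric.tendstoUniformly_iff.1 (hconv 1 (by norm_num)) _ hδ,
    Metric.tendstoUniformly_iff.1 (hconv 2 (by norm_num)) _ hδ, eventually_ne_atTop 0]
    with n hn h1 h2 hn0 θ t ht
  obtain ⟨u, hu⟩ := exists_norm_smul_sphere ht
  have hs : ‖t‖ ≠ 0 := norm_ne_zero_iff.2 ht
  obtain ⟨hM, hD⟩ := hn (u, θ)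
  have h := norm_kappa_le hn0 hs (m := m θ u) hd hM hD
  have hm : m θ t = fun ν => ‖t‖ ^ ν * m θ u ν := by
    funext ν
    conv_lhs => rw [hu]
    exact hscale θ u ‖t‖ ν
  rw [← hm, ← hu] at h
  refine h.trans ?_
  have e1 := (h1 (u, θ)).le
  have e2 := (h2 (u, θ)).le
  rw [dist_comm, Real.dist_eq] at e1 e2
  calc K * (|rawMoment n (y θ) u 1 - m θ u 1| + |rawMoment n (y θ) u 2 - m θ u 2|)
      ≤ (K + 1) * (ε / (2 * (K + 1)) + ε / (2 * (K + 1))) :=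
        mul_le_mul (by linarith) (add_le_add e1 e2) (by positivity) (by positivity)
    _ = ε := by field_simp; ring

/-- For large `n` the empirical covariance matrix of the control functions is invertible at every
parameter, so its inverse causes no discontinuity. -/
lemma eventually_continuous_kappa [CompactSpace T] (hy : ∀ j, Continuous fun θ => y θ j)
    (hconv : ∀ ν ≤ 4, TendstoUniformly
      (fun (n : ℕ) (z : Metric.sphere (0 : EuclideanSpace ℝ (Fin p)) 1 × T) =>
        rawMoment n (y z.2) z.1 ν) (fun z => m z.2 z.1 ν) atTop)
    (hdet : ∀ θ t, t ≠ 0 → 0 < momentDet (m θ t))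
    (hscale : ∀ θ t (s : ℝ) ν, m θ (s • t) ν = s ^ ν * m θ t ν) :
    ∀ᶠ n in atTop, ∀ t, t ≠ 0 → Continuous fun θ => kappa n (y θ) t (m θ t) := by
  obtain ⟨B, d, hB, hd, hev⟩ := eventually_rawMoment_bounds hy hconv hdet
  filter_upwards [hev, eventually_ne_atTop 0] with n hn hn0 t ht
  obtain ⟨u, hu⟩ := exists_norm_smul_sphere ht
  have hs : ‖t‖ ≠ 0 := norm_ne_zero_iff.2 ht
  have hm : ∀ ν ≤ 4, Continuous fun θ => m θ t ν := by
    intro ν hν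
    have h1 : (fun θ => m θ t ν) = fun θ => ‖t‖ ^ ν * m θ u ν := by
      funext θ
      conv_lhs => rw [hu]
      exact hscale θ u ‖t‖ ν
    rw [h1]
    exact continuous_const.mul ((continuous_of_tendstoUniformly_rawMoment hy (hconv ν hν)).comp
      (continuous_const.prodMk continuous_id : Continuous fun θ : T => (u, θ)))
  simp only [kappa_eq_correction hn0]
  refine continuous_correction (fun ν => continuous_rawMoment n hy continuous_const ν)
    (m := fun ν θ => m θ t ν) (hm 1 (by norm_num)) (hm 2 (by norm_num))
    (fun ν => continuous_mixedMoment n hy continuous_const ν) fun θ => ?_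
  have h1 : (fun ν => rawMoment n (y θ) t ν) = fun ν => ‖t‖ ^ ν * rawMoment n (y θ) u ν := by
    funext ν
    conv_lhs => rw [hu]
    exact rawMoment_smul n (y θ) ‖t‖ u ν
  rw [h1, momentDet_scale]
  exact mul_ne_zero (pow_ne_zero _ hs) (hd.trans_le (hn (u, θ)).2).ne'

end Vanishing

/-! ### Convergence of minimizers of integral criteria -/

section Argmin

/-- Minimizers of `θ ↦ ∫ F n θ` converge to the minimizer of the limit criterion `∫ Flim`, when the
integrands are continuous in the parameter, dominated, and converge jointly in `n` and the
parameter. The criteria are then continuous for large `n`, so that minimizers exist. -/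
theorem tendsto_argmin {T S : Type*} [TopologicalSpace T] [CompactSpace T]
    [FirstCountableTopology T] [MeasurableSpace S] {μ : Measure S} {F : ℕ → T → S → ℝ}
    {Flim : T → S → ℝ} {g : S → ℝ} (hg : Integrable g μ)
    (hmeas : ∀ᶠ n in atTop, ∀ θ, AEStronglyMeasurable (F n θ) μ)
    (hbound : ∀ᶠ n in atTop, ∀ θ, ∀ᵐ s ∂μ, ‖F n θ s‖ ≤ g s)
    (hcont : ∀ᶠ n in atTop, ∀ᵐ s ∂μ, Continuous fun θ => F n θ s)
    (hlim : ∀ θ, ∀ᵐ s ∂μ, Tendsto (fun z : ℕ × T => F z.1 z.2 s) (atTop ×ˢ 𝓝 θ) (𝓝 (Flim θ s)))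
    {θ₀ : T} (h0 : ∫ s, Flim θ₀ s ∂μ = 0) (huniq : ∀ θ, ∫ s, Flim θ s ∂μ ≤ 0 → θ = θ₀)
    {θhat : ℕ → T} (hθ : IsArgminSeq (fun n θ => ∫ s, F n θ s ∂μ) θhat) :
    Tendsto θhat atTop (𝓝 θ₀) := by
  have hQ : ∀ θ, Tendsto (fun z : ℕ × T => ∫ s, F z.1 z.2 s ∂μ) (atTop ×ˢ 𝓝 θ)
      (𝓝 (∫ s, Flim θ s ∂μ)) := by
    intro θ
    refine tendsto_integral_filter_of_dominated_convergence g ?_ ?_ hg (hlim θ)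
    · exact (hmeas.prod_inl (𝓝 θ)).mono fun z hz => hz z.2
    · exact (hbound.prod_inl (𝓝 θ)).mono fun z hz => hz z.2
  have hmin : ∀ᶠ n in atTop, ∫ s, F n (θhat n) s ∂μ ≤ ∫ s, F n θ₀ s ∂μ := by
    filter_upwards [hmeas, hbound, hcont] with n h1 h2 h3
    refine hθ n ?_ θ₀
    obtain ⟨θ, -, hmin⟩ := isCompact_univ.exists_isMinOn ⟨θ₀, Set.mem_univ _⟩
      (continuous_of_dominated h1 h2 hg h3).continuousOn
    exact ⟨θ, fun θ' => hmin (Set.mem_univ θ')⟩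
  refine tendsto_nhds_of_unique_mapClusterPt fun θ hcl => huniq θ ?_
  obtain ⟨U, hU, hUθ⟩ := mapClusterPt_iff_ultrafilter.1 hcl
  have hid : Tendsto (fun n : ℕ => n) (U : Filter ℕ) atTop := hU
  have h1 := (hQ θ).comp (hid.prodMk hUθ)
  have h2 := (hQ θ₀).comp (hid.prodMk (tendsto_const_nhds (x := θ₀)))
  rw [h0] at h2
  exact le_of_tendsto_of_tendsto h1 h2 (hU hmin)

variable {p : ℕ}

/-- The approximation of the characteristic function used in `Qcv` at sample size `n`: with
control variates where the estimated variance is below `k`, plain Monte Carlo elsewhere. -/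
noncomputable def mixedChf (n H : ℕ) (k : ℝ) (x : ℤ → ℝ) (y : ℕ → EuclideanSpace ℝ (Fin p))
    (m : EuclideanSpace ℝ (Fin p) → ℕ → ℝ) (t : EuclideanSpace ℝ (Fin p)) : ℂ :=
  if estVar p n x t < k then cvChf H y t (m t) else mcChf H y t

lemma norm_mixedChf_sub_mcChf_le (n H : ℕ) (k : ℝ) (x : ℤ → ℝ)
    (y : ℕ → EuclideanSpace ℝ (Fin p)) (m : EuclideanSpace ℝ (Fin p) → ℕ → ℝ)
    (t : EuclideanSpace ℝ (Fin p)) :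
    ‖mixedChf n H k x y m t - mcChf H y t‖ ≤ ‖kappa H y t (m t)‖ := by
  rw [mixedChf]
  split_ifs
  · simp [cvChf]
  · simp

/-- Convergence of the estimator along one realization `x` of the data and `y` of the simulations,
from convergence of the empirical characteristic functions and uniform smallness of the control
variates correction. -/
theorem tendsto_of_isArgminSeq_Qcv {T : Type*} [TopologicalSpace T] [CompactSpace T]
    [FirstCountableTopology T] (hp : 0 < p) {x : ℤ → ℝ} {y : T → ℕ → EuclideanSpace ℝ (Fin p)}
    {m : T → EuclideanSpace ℝ (Fin p) → ℕ → ℝ} {φ : T → EuclideanSpace ℝ (Fin p) → ℂ}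
    {V : EuclideanSpace ℝ (Fin p) → ℝ} {θ₀ : T}
    (hecf : ∀ᵐ t, Tendsto (fun n => ecf p n x t) atTop (𝓝 (φ θ₀ t)))
    (hlow : ∃ c > 0, ∀ᶠ n in atTop, ∀ t : EuclideanSpace ℝ (Fin p), c * ‖t‖ ^ 2 ≤ estVar p n x t)
    (hV : ∀ t, Tendsto (fun n => estVar p n x t) atTop (𝓝 (V t)))
    (hy : ∀ j, Continuous fun θ => y θ j)
    (hmc : ∀ t, TendstoUniformly (fun n θ => mcChf n (y θ) t) (fun θ => φ θ t) atTop)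
    (hκ : ∀ ε > 0, ∀ᶠ n in atTop, ∀ θ t, t ≠ 0 → ‖kappa n (y θ) t (m θ t)‖ ≤ ε)
    (hκc : ∀ᶠ n in atTop, ∀ t, t ≠ 0 → Continuous fun θ => kappa n (y θ) t (m θ t))
    (hm : ∀ θ ν, Measurable fun t => m θ t ν) (hφ : ∀ θ, Continuous (φ θ))
    (hid : ∀ θ, (∀ t, φ θ t = φ θ₀ t) → θ = θ₀)
    {w : EuclideanSpace ℝ (Fin p) → ℝ} (hwpos : ∀ᵐ t, 0 < w t) (hwint : Integrable w)
    (hwint2 : Integrable fun t => w t / ‖t‖ ^ 2) {k : ℝ} {H : ℕ → ℕ} (hH : Tendsto H atTop atTop)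
    {θhat : ℕ → T} (hθ : IsArgminSeq (fun n θ => Qcv n (H n) k w x (y θ) (m θ)) θhat) :
    Tendsto θhat atTop (𝓝 θ₀) := by
  obtain ⟨c, hc0, hc⟩ := hlow
  have : Nonempty (Fin p) := ⟨⟨0, hp⟩⟩
  have hne : ∀ᵐ t : EuclideanSpace ℝ (Fin p), t ≠ 0 := Measure.ae_ne _ 0
  have hVlow : ∀ t, c * ‖t‖ ^ 2 ≤ V t := fun t =>
    ge_of_tendsto (hV t) (hc.mono fun n hn => hn t)
  have hweight : ∀ (t : EuclideanSpace ℝ (Fin p)) (v : ℝ), t ≠ 0 → c * ‖t‖ ^ 2 ≤ v →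
      ‖w t / v‖ ≤ c⁻¹ * ‖w t / ‖t‖ ^ 2‖ := by
    intro t v ht hv
    have hn : 0 < ‖t‖ := norm_pos_iff.2 ht
    have hcn : 0 < c * ‖t‖ ^ 2 := by positivity
    rw [norm_div, norm_div, Real.norm_of_nonneg (hcn.le.trans hv),
      Real.norm_of_nonneg (sq_nonneg ‖t‖)]
    refine (div_le_div_of_nonneg_left (norm_nonneg _) hcn hv).trans_eq ?_
    field_simp
  -- `ecf`, `mcChf` and, eventually, the correction are at most one in norm: hence `9 = 3 ^ 2`
  have hdom : ∀ (t : EuclideanSpace ℝ (Fin p)) (v : ℝ) (z : ℂ), t ≠ 0 → c * ‖t‖ ^ 2 ≤ v →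
      ‖z‖ ≤ 3 → ‖‖z‖ ^ 2 * (w t / v)‖ ≤ 9 * (c⁻¹ * ‖w t / ‖t‖ ^ 2‖) := by
    intro t v z ht hv hz
    rw [norm_mul, norm_pow, norm_norm]
    exact mul_le_mul (by nlinarith [norm_nonneg z]) (hweight t v ht hv) (norm_nonneg _)
      (by norm_num)
  have hgint : Integrable fun t : EuclideanSpace ℝ (Fin p) =>
      9 * (c⁻¹ * ‖w t / ‖t‖ ^ 2‖) := (hwint2.norm.const_mul _).const_mul _
  have hVm : Measurable V := measurable_of_tendsto_metrizable (fun n => measurable_estVar n x)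
    (tendsto_pi_nhds.2 hV)
  have hφ1 : ∀ θ t, ‖φ θ t‖ ≤ 1 := fun θ t =>
    le_of_tendsto ((hmc t).tendsto_at θ).norm (Eventually.of_forall fun n => norm_mcChf_le _ _ _)
  have hφc : ∀ t, Continuous fun θ => φ θ t := fun t => (hmc t).continuous
    (Frequently.of_forall fun n => continuous_mcChf n hy continuous_const)
  have hκ1 := hH.eventually (hκ 1 one_pos)
  refine tendsto_argmin (μ := volume) (F := fun n θ t =>
      ‖ecf p n x t - mixedChf n (H n) k x (y θ) (m θ) t‖ ^ 2 * (w t / estVar p n x t))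
    (Flim := fun θ t => ‖φ θ₀ t - φ θ t‖ ^ 2 * (w t / V t)) hgint ?_ ?_ ?_ ?_ ?_ ?_ hθ
  · filter_upwards [hH.eventually_ne_atTop 0] with n hn θ
    have hmc' : Measurable fun t => mcChf (H n) (y θ) t :=
      (continuous_mcChf (y := fun _ => y θ) (H n) (fun _ => continuous_const)
        continuous_id).measurable
    have hmix : Measurable fun t => mixedChf n (H n) k x (y θ) (m θ) t :=
      Measurable.ite (measurableSet_lt (measurable_estVar n x) measurable_const)
        (hmc'.sub (measurable_kappa hn (y θ) (hm θ))) hmc'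
    exact (((measurable_ecf n x).sub hmix).norm.pow_const 2).aestronglyMeasurable.mul
      (hwint.aestronglyMeasurable.aemeasurable.div
        (measurable_estVar n x).aemeasurable).aestronglyMeasurable
  · filter_upwards [hc, hκ1] with n hcn hκn θ
    filter_upwards [hne] with t ht
    refine hdom t _ _ ht (hcn t) ?_
    have h1 := norm_ecf_le n x t
    have h2 := norm_mcChf_le (H n) (y θ) t
    have h3 := (norm_mixedChf_sub_mcChf_le n (H n) k x (y θ) (m θ) t).trans (hκn θ t ht)
    have h4 : ecf p n x t - mixedChf n (H n) k x (y θ) (m θ) t = ecf p n x t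
        - mcChf (H n) (y θ) t - (mixedChf n (H n) k x (y θ) (m θ) t - mcChf (H n) (y θ) t) := by
      ring
    rw [h4]
    have h5 := norm_sub_le (ecf p n x t - mcChf (H n) (y θ) t)
      (mixedChf n (H n) k x (y θ) (m θ) t - mcChf (H n) (y θ) t)
    have h6 := norm_sub_le (ecf p n x t) (mcChf (H n) (y θ) t)
    linarith
  · filter_upwards [hH.eventually hκc] with n hn
    filter_upwards [hne] with t ht
    have h1 : Continuous fun θ => mcChf (H n) (y θ) t := continuous_mcChf _ hy continuous_const
    have h2 : Continuous fun θ => mixedChf n (H n) k x (y θ) (m θ) t := by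
      simp only [mixedChf]
      split_ifs
      · exact h1.sub (hn t ht)
      · exact h1
    fun_prop
  · intro θ
    filter_upwards [hne, hecf] with t ht htecf
    have hn : 0 < ‖t‖ := norm_pos_iff.2 ht
    have hVt : V t ≠ 0 := ((by positivity : 0 < c * ‖t‖ ^ 2).trans_le (hVlow t)).ne'
    have hfst : Tendsto (fun z : ℕ × T => z.1) (atTop ×ˢ 𝓝 θ) atTop := tendsto_fst
    have hunif : TendstoUniformly (fun (z : ℕ × T) θ => mcChf (H z.1) (y θ) t)
        (fun θ => φ θ t) (atTop ×ˢ 𝓝 θ) := fun u hu =>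
      (hH.comp hfst).eventually (hmc t u hu)
    have hmc' := hunif.tendsto_comp (hφc t).continuousAt tendsto_snd
    have hdiff : Tendsto (fun z : ℕ × T => mixedChf z.1 (H z.1) k x (y z.2) (m z.2) t
        - mcChf (H z.1) (y z.2) t) (atTop ×ˢ 𝓝 θ) (𝓝 0) := by
      rw [Metric.tendsto_nhds]
      intro ε hε
      filter_upwards [(hH.comp hfst).eventually (hκ (ε / 2) (half_pos hε))] with z hz
      rw [dist_zero_right]
      exact ((norm_mixedChf_sub_mcChf_le _ _ _ _ _ _ _).trans (hz z.2 t ht)).trans_lt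
        (half_lt_self hε)
    have hmix := hmc'.add hdiff
    simp only [add_sub_cancel, add_zero] at hmix
    exact (((htecf.comp hfst).sub hmix).norm.pow 2).mul
      (tendsto_const_nhds.div ((hV t).comp hfst) hVt)
  · simp
  · intro θ hθ0
    refine hid θ fun t => ?_
    have hnonneg : 0 ≤ᵐ[volume] fun t => ‖φ θ₀ t - φ θ t‖ ^ 2 * (w t / V t) := by
      filter_upwards [hwpos] with t hwt
      have : 0 ≤ V t := le_trans (by positivity) (hVlow t)
      show 0 ≤ ‖φ θ₀ t - φ θ t‖ ^ 2 * (w t / V t)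
      positivity
    have hint : Integrable fun t => ‖φ θ₀ t - φ θ t‖ ^ 2 * (w t / V t) := by
      refine Integrable.mono' hgint ?_ ?_
      · exact ((((hφ θ₀).sub (hφ θ)).measurable.norm.pow_const 2).aestronglyMeasurable).mul
          (hwint.aestronglyMeasurable.aemeasurable.div hVm.aemeasurable).aestronglyMeasurable
      · filter_upwards [hne] with t ht
        refine hdom t _ _ ht (hVlow t) ?_
        have := norm_sub_le (φ θ₀ t) (φ θ t)
        linarith [hφ1 θ₀ t, hφ1 θ t]
    have hz := (integral_eq_zero_iff_of_nonneg_ae hnonneg hint).1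
      (le_antisymm hθ0 (integral_nonneg_of_ae hnonneg))
    have hae : φ θ =ᵐ[volume] φ θ₀ := by
      filter_upwards [hz, hwpos, hne] with t h1 h2 h3
      have hn : 0 < ‖t‖ := norm_pos_iff.2 h3
      have hVt : 0 < V t := (by positivity : 0 < c * ‖t‖ ^ 2).trans_le (hVlow t)
      have h4 : ‖φ θ₀ t - φ θ t‖ ^ 2 = 0 :=
        (mul_eq_zero.1 h1).resolve_right (div_pos h2 hVt).ne'
      exact (sub_eq_zero.1 (norm_eq_zero.1 (pow_eq_zero_iff two_ne_zero |>.1 h4))).symm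
    exact congrFun ((hφ θ).ae_eq_iff_eq volume (hφ θ₀) |>.1 hae) t

end Argmin

/-! ### Transfer from the model to the data and the simulations -/

section Transfer

variable {Ω Ω' Θ : Type*} [MeasurableSpace Ω] [MeasurableSpace Ω'] {P : Measure Ω}
  {P' : Measure Ω'} {p : ℕ} {Y : ℤ → Θ → Ω' → ℝ} {Z : ℕ → Θ → Ω → EuclideanSpace ℝ (Fin p)}

lemma lintegral_iSup_simulated_lt_top [TopologicalSpace Θ] [TopologicalSpace.SeparableSpace Θ]
    [Nonempty Θ] (hcont : ∀ j ω, Continuous fun θ => Z j θ ω)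
    (hYmeas : ∀ j θ, Measurable (Y j θ))
    (hYstat : IdentDistrib (fun ω (i : ℤ) (θ : Θ) => Y (i + 1) θ ω)
      (fun ω (i : ℤ) (θ : Θ) => Y i θ ω) P' P')
    (hYmom : ∫⁻ ω, (⨆ θ : Θ, ‖Y 1 θ ω‖ₑ ^ 4) ∂P' < ⊤)
    (hlaw : IdentDistrib (fun ω (θ : Θ) => Z 0 θ ω) (fun ω (θ : Θ) => modelBlock p Y θ ω) P P') :
    ∫⁻ ω, ⨆ θ, ‖Z 0 θ ω‖ₑ ^ 4 ∂P < ⊤ := by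
  set D := TopologicalSpace.denseSeq Θ
  have hg : Measurable fun (x : Θ → EuclideanSpace ℝ (Fin p)) => ⨆ n, ‖x (D n)‖ₑ ^ 4 :=
    Measurable.iSup fun n => (measurable_pi_apply (D n)).enorm.pow_const 4
  have h := (hlaw.comp hg).lintegral_eq
  simp only [Function.comp_def] at h
  refine lt_of_le_of_lt (lintegral_mono fun ω => iSup_le fun θ => ?_)
    (h.trans_lt (lintegral_iSup_modelBlock_lt_top hYmeas hYstat hYmom D))
  have hcl : IsClosed {θ | ‖Z 0 θ ω‖ₑ ^ 4 ≤ ⨆ n, ‖Z 0 (D n) ω‖ₑ ^ 4} :=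
    isClosed_le ((ENNReal.continuous_pow 4).comp (hcont 0 ω).enorm) continuous_const
  exact (TopologicalSpace.denseRange_denseSeq Θ).induction_on θ hcl fun n =>
    le_iSup (fun n => ‖Z 0 (D n) ω‖ₑ ^ 4) n

lemma modelMoment_eq_integral
    (hlaw : IdentDistrib (fun ω (θ : Θ) => Z 0 θ ω) (fun ω (θ : Θ) => modelBlock p Y θ ω) P P')
    (θ : Θ) (t : EuclideanSpace ℝ (Fin p)) (ν : ℕ) :
    modelMoment p P' Y θ t ν = ∫ ω, (inner ℝ t (Z 0 θ ω) : ℝ) ^ ν ∂P := by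
  have hg : Measurable fun x : Θ → EuclideanSpace ℝ (Fin p) => (inner ℝ t (x θ) : ℝ) ^ ν := by
    fun_prop
  exact (hlaw.comp hg).integral_eq.symm

lemma modelChf_eq_integral
    (hlaw : IdentDistrib (fun ω (θ : Θ) => Z 0 θ ω) (fun ω (θ : Θ) => modelBlock p Y θ ω) P P')
    (t : EuclideanSpace ℝ (Fin p)) (θ : Θ) :
    modelChf p P' Y t θ = ∫ ω, expChar t (Z 0 θ ω) ∂P := by
  have hg : Measurable fun x : Θ → EuclideanSpace ℝ (Fin p) => expChar t (x θ) := by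
    unfold expChar
    fun_prop
  exact (hlaw.comp hg).integral_eq.symm

lemma modelMoment_smul (θ : Θ) (t : EuclideanSpace ℝ (Fin p)) (s : ℝ) (ν : ℕ) :
    modelMoment p P' Y θ (s • t) ν = s ^ ν * modelMoment p P' Y θ t ν := by
  simp only [modelMoment, ← integral_const_mul, inner_smul_left, mul_pow]
  rfl

lemma measurable_modelBlock (hYmeas : ∀ j θ, Measurable (Y j θ)) (θ : Θ) :
    Measurable fun ω => modelBlock p Y θ ω :=
  (measurable_block p 1).comp (measurable_pi_lambda _ fun i => hYmeas i θ)

lemma measurable_modelMoment [SFinite P'] (hYmeas : ∀ j θ, Measurable (Y j θ)) (θ : Θ) (ν : ℕ) :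
    Measurable fun t : EuclideanSpace ℝ (Fin p) => modelMoment p P' Y θ t ν := by
  have hb := measurable_modelBlock (p := p) hYmeas θ
  have h : StronglyMeasurable fun z : EuclideanSpace ℝ (Fin p) × Ω' =>
      (inner ℝ z.1 (modelBlock p Y θ z.2) : ℝ) ^ ν :=
    (by fun_prop : Measurable fun z : EuclideanSpace ℝ (Fin p) × Ω' =>
      (inner ℝ z.1 (modelBlock p Y θ z.2) : ℝ) ^ ν).stronglyMeasurable
  exact h.integral_prod_right'.measurable

lemma continuous_modelChf [IsFiniteMeasure P'] (hYmeas : ∀ j θ, Measurable (Y j θ)) (θ : Θ) :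
    Continuous fun t : EuclideanSpace ℝ (Fin p) => modelChf p P' Y t θ := by
  have hb := measurable_modelBlock (p := p) hYmeas θ
  refine continuous_of_dominated (bound := fun _ => 1) (fun t => ?_)
    (fun t => ae_of_all _ fun ω => (norm_expChar _ _).le) (integrable_const _)
    (ae_of_all _ fun ω => ?_)
  · have : Measurable fun ω => expChar t (modelBlock p Y θ ω) := by
      unfold expChar
      fun_prop
    exact this.aestronglyMeasurable
  · unfold expChar
    fun_prop

lemma momentDet_modelMoment_pos [IsProbabilityMeasure P] [IsProbabilityMeasure P']
    (hmeas : ∀ j θ, Measurable (Z j θ)) (hmom : ∫⁻ ω, ⨆ θ, ‖Z 0 θ ω‖ₑ ^ 4 ∂P < ⊤)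
    (hlaw : IdentDistrib (fun ω (θ : Θ) => Z 0 θ ω) (fun ω (θ : Θ) => modelBlock p Y θ ω) P P')
    (θ : Θ) (t : EuclideanSpace ℝ (Fin p))
    (hnd : ∀ a b c : ℝ, (∀ᵐ ω ∂P', a * (inner ℝ t (modelBlock p Y θ ω) : ℝ)
        + b * (inner ℝ t (modelBlock p Y θ ω) : ℝ) ^ 2 + c = 0) → a = 0 ∧ b = 0 ∧ c = 0) :
    0 < momentDet (modelMoment p P' Y θ t) := by
  refine momentDet_pos (fun ν hν => ?_) hnd
  have hg : Measurable fun x : Θ → EuclideanSpace ℝ (Fin p) => (inner ℝ t (x θ) : ℝ) ^ ν := by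
    fun_prop
  exact (hlaw.comp hg).integrable_iff.1 (integrable_inner_pow hmeas hmom θ t hν)

/-- At each parameter the model has a finite second moment; at the true parameter this is the second
moment of the observed series. -/
lemma memLp_two_of_lintegral_iSup [IsFiniteMeasure P'] (hYmeas : ∀ j θ, Measurable (Y j θ))
    (hYmom : ∫⁻ ω, (⨆ θ : Θ, ‖Y 1 θ ω‖ₑ ^ 4) ∂P' < ⊤) (θ : Θ) : MemLp (Y 1 θ) 2 P' := by
  have h4 : MemLp (Y 1 θ) 4 P' := by
    refine ⟨(hYmeas 1 θ).aestronglyMeasurable, ?_⟩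
    rw [eLpNorm_lt_top_iff_lintegral_rpow_enorm_lt_top (by norm_num) (by norm_num)]
    refine lt_of_le_of_lt (lintegral_mono fun ω => ?_) hYmom
    refine le_trans (le_of_eq ?_) (le_iSup (fun θ => ‖Y 1 θ ω‖ₑ ^ 4) θ)
    norm_num
  exact h4.mono_exponent (by norm_num)

end Transfer

end CFEst

/-! ### Consistency of the control variates estimator -/

theorem theorem3p2
    {Ω Ω' : Type*} [MeasurableSpace Ω] [MeasurableSpace Ω']
    -- `P`: the space of the data and of the simulations; `P'`: the space of the model
    (P : Measure Ω) [IsProbabilityMeasure P] (P' : Measure Ω') [IsProbabilityMeasure P']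
    (p q : ℕ) (hp : 0 < p)
    -- compact parameter space, true parameter in its interior
    (Θ : Set (EuclideanSpace ℝ (Fin q))) (hΘ : IsCompact Θ)
    (θ₀ : Θ) (hθ₀ : (θ₀ : EuclideanSpace ℝ (Fin q)) ∈ interior Θ)
    -- the model `X_j(θ)`, stationary in `j` (as a family of random functions of `θ`)
    (Y : ℤ → Θ → Ω' → ℝ) (hYmeas : ∀ j θ, Measurable (Y j θ))
    (hYstat : IdentDistrib (fun ω (i : ℤ) (θ : Θ) => Y (i + 1) θ ω)
      (fun ω (i : ℤ) (θ : Θ) => Y i θ ω) P' P')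
    -- the observed series: it follows the model at the true parameter, is stationary and ergodic,
    -- and is strongly mixing with a summability and a matching moment condition
    (X : ℤ → Ω → ℝ) (hXmeas : ∀ j, Measurable (X j))
    (hXlaw : IdentDistrib (fun ω (i : ℤ) => X i ω) (fun ω (i : ℤ) => Y i θ₀ ω) P P')
    (hXerg : CFEst.IsStationaryErgodic P X)
    (r : ℝ) (hr : 1 < r)
    (hmix : Summable fun j : ℕ => CFEst.alphaCoeff P X j ^ (1 / r))
    (hXmom : Integrable (fun ω => |X 1 ω| ^ (2 * r / (r - 1))) P)
    -- the simulated blocks: iid copies of the model block (as random functions of `θ`),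
    -- independent of the observed series, continuous in `θ`
    (Xsim : ℕ → Θ → Ω → EuclideanSpace ℝ (Fin p)) (hSmeas : ∀ j θ, Measurable (Xsim j θ))
    (hSlaw : ∀ j, IdentDistrib (fun ω (θ : Θ) => Xsim j θ ω)
      (fun ω (θ : Θ) => CFEst.modelBlock p Y θ ω) P P')
    (hSindep : iIndepFun (fun (j : ℕ) ω (θ : Θ) => Xsim j θ ω) P)
    (hXS : IndepFun (fun ω (i : ℤ) => X i ω) (fun ω (j : ℕ) (θ : Θ) => Xsim j θ ω) P)
    (hScont : ∀ j ω, Continuous fun θ : Θ => Xsim j θ ω)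
    -- the supremum over `θ` of `|X_1(θ)|` has a finite fourth moment
    (hYmom : ∫⁻ ω, (⨆ θ : Θ, ‖Y 1 θ ω‖ₑ ^ 4) ∂P' < ⊤)
    -- the control variates are nondegenerate
    (hnd : ∀ (θ : Θ) (t : EuclideanSpace ℝ (Fin p)), t ≠ 0 → ∀ a b c : ℝ,
      (∀ᵐ ω ∂P', a * (inner ℝ t (CFEst.modelBlock p Y θ ω) : ℝ)
        + b * (inner ℝ t (CFEst.modelBlock p Y θ ω) : ℝ) ^ 2 + c = 0) →
      a = 0 ∧ b = 0 ∧ c = 0)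
    -- identifiability from the characteristic function of the blocks
    (hid : ∀ θ : Θ, (∀ t, CFEst.modelChf p P' Y t θ = CFEst.modelChf p P' Y t θ₀) → θ = θ₀)
    -- the weight function
    (w : EuclideanSpace ℝ (Fin p) → ℝ) (hwpos : ∀ᵐ t, 0 < w t)
    (hwint : Integrable w) (hwint2 : Integrable fun t => w t / ‖t‖ ^ 2)
    -- threshold, number of simulations, and estimator
    (k : ℝ) (hk : 0 < k)
    (H : ℕ → ℕ) (hH : Tendsto H atTop atTop)
    (θhat : ℕ → Ω → Θ)
    (hθhat : ∀ᵐ ω ∂P, CFEst.IsArgminSeq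
      (fun n (θ : Θ) => CFEst.Qcv n (H n) k w (fun i => X i ω) (fun j => Xsim j θ ω)
        (CFEst.modelMoment p P' Y θ))
      (fun n => θhat n ω)) :
    ∀ᵐ ω ∂P, Tendsto (fun n => (θhat n ω : EuclideanSpace ℝ (Fin q))) atTop
      (𝓝 (θ₀ : EuclideanSpace ℝ (Fin q))) := by
  have : CompactSpace Θ := isCompact_iff_compactSpace.1 hΘ
  have : Nonempty Θ := ⟨θ₀⟩
  have : Nonempty (Fin p) := ⟨⟨0, hp⟩⟩
  have : Nonempty (Metric.sphere (0 : EuclideanSpace ℝ (Fin p)) 1) :=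
    (NormedSpace.sphere_nonempty.2 zero_le_one).to_subtype
  -- the law of the observed series on sequence space
  have hXm : Measurable fun ω (i : ℤ) => X i ω := measurable_pi_lambda _ hXmeas
  have hYm : Measurable fun ω (i : ℤ) => Y i θ₀ ω := measurable_pi_lambda _ fun i => hYmeas i θ₀
  set μ : Measure (ℤ → ℝ) := P.map (fun ω (i : ℤ) => X i ω) with hμ
  have : IsProbabilityMeasure μ := Measure.isProbabilityMeasure_map hXm.aemeasurable
  have hμY : μ = P'.map (fun ω (i : ℤ) => Y i θ₀ ω) := hXlaw.map_eq
  have herg : Ergodic CFEst.shift μ := hXerg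
  have h2 : MemLp (fun x : ℤ → ℝ => x 1) 2 μ := by
    rw [hμY, memLp_map_measure_iff (measurable_pi_apply _).aestronglyMeasurable hYm.aemeasurable]
    exact CFEst.memLp_two_of_lintegral_iSup hYmeas hYmom θ₀
  have hVpos : ∀ t : EuclideanSpace ℝ (Fin p), t ≠ 0 → 0 < CFEst.blockVar μ p t := by
    refine fun t ht => CFEst.blockVar_pos herg h2 fun c hc => ?_
    rw [hμY] at hc
    have h1 := hnd θ₀ t ht 1 0 (-c) (by
      filter_upwards [ae_of_ae_map hYm.aemeasurable hc] with ω hω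
      have h3 : (inner ℝ t (CFEst.modelBlock p Y θ₀ ω) : ℝ) = c := hω
      rw [h3]
      ring)
    exact one_ne_zero h1.1
  have hchf : ∀ t : EuclideanSpace ℝ (Fin p),
      ∫ x, CFEst.expChar t (CFEst.block p x 1) ∂μ = CFEst.modelChf p P' Y t θ₀ := by
    intro t
    have hb := CFEst.measurable_block p 1
    have hm : Measurable fun x : ℤ → ℝ => CFEst.expChar t (CFEst.block p x 1) := by
      unfold CFEst.expChar
      fun_prop
    rw [hμY, integral_map hYm.aemeasurable hm.aestronglyMeasurable]
    rfl
  have hdata : ∀ᵐ ω ∂P, ∀ h, Tendsto (fun n => CFEst.sampleAutocov n (fun i => X i ω) h) atTop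
      (𝓝 (CFEst.autocov μ h)) :=
    ae_of_ae_map hXm.aemeasurable (ae_all_iff.2 (CFEst.ae_tendsto_sampleAutocov herg h2))
  have hecf := ae_of_ae_map hXm.aemeasurable (CFEst.ae_tendsto_ecf herg p)
  -- the simulations
  have hident : ∀ j, IdentDistrib (fun ω (θ : Θ) => Xsim j θ ω) (fun ω (θ : Θ) => Xsim 0 θ ω) P P :=
    fun j => (hSlaw j).trans (hSlaw 0).symm
  have hmom := CFEst.lintegral_iSup_simulated_lt_top hScont hYmeas hYstat hYmom (hSlaw 0)
  have hraw := CFEst.ae_tendstoUniformly_rawMoment hSmeas hScont hident hSindep hmom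
  have hmc := CFEst.ae_tendstoUniformly_mcChf hSmeas hScont hident hSindep hmom
  have hdet : ∀ (θ : Θ) (t : EuclideanSpace ℝ (Fin p)), t ≠ 0 →
      0 < CFEst.momentDet (CFEst.modelMoment p P' Y θ t) := fun θ t ht =>
    CFEst.momentDet_modelMoment_pos hSmeas hmom (hSlaw 0) θ t (hnd θ t ht)
  simp only [← CFEst.modelMoment_eq_integral (hSlaw 0)] at hraw
  simp only [← CFEst.modelChf_eq_integral (hSlaw 0)] at hmc
  filter_upwards [hdata, hecf, hraw, hmc, hθhat] with ω hdata hecf hraw hmc hargmin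
  simp only [hchf] at hecf
  have hy : ∀ j, Continuous fun θ : Θ => Xsim j θ ω := fun j => hScont j ω
  have hlim := CFEst.tendsto_of_isArgminSeq_Qcv (φ := fun θ t => CFEst.modelChf p P' Y t θ)
    (y := fun θ j => Xsim j θ ω) (m := CFEst.modelMoment p P' Y) hp hecf
    (CFEst.eventually_le_estVar hVpos hdata) (CFEst.tendsto_estVar hdata) hy hmc
    (fun ε hε => CFEst.eventually_norm_kappa_le hy hraw hdet CFEst.modelMoment_smul hε)
    (CFEst.eventually_continuous_kappa hy hraw hdet CFEst.modelMoment_smul)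
    (CFEst.measurable_modelMoment hYmeas) (CFEst.continuous_modelChf hYmeas) hid
    hwpos hwint hwint2 hH hargmin
  exact (continuous_subtype_val.tendsto θ₀).comp hlim
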